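/- Let $n\ge 1$ and let $(M,g)$ be a non-empty smooth Riemannian manifold of dimension $4n+3$ with an almost $3$-contact metric structure: for $i=1,2,3$ there are a $(1,1)$-tensor field $\varphi_i$, a vector field $\xi_i$ and a $1$-form $\eta_i$ (all smooth) with $\varphi_i^2=-I+\eta_i\otimes\xi_i$, $\eta_i(\xi_i)=1$, $g(\varphi_iX,\varphi_iY)=g(X,Y)-\eta_i(X)\eta_i(Y)$, and, for every even permutation $(i,j,k)$ of $(1,2,3)$, $$\varphi_k=\varphi_i\varphi_j-\eta_j\otimes\xi_i=-\varphi_j\varphi_i+\eta_i\otimes\xi_j,\quad \xi_k=\varphi_i\xi_j=-\varphi_j\xi_i,\quad \eta_k=\eta_i\circ\varphi_j=-\eta_j\circ\varphi_i .$$ Assume that it is a $3$-$(\alpha,\delta)$-Sasaki structure, i.e. $\alpha\neq0$ and $\delta$ are real constants such that, for every even permutation $(i,j,k)$ of $(1,2,3)$, $$d\eta_i=2\alpha\Phi_i+2(\alpha-\delta)\,\eta_j\wedge\eta_k,\qquad \Phi_i(X,Y)=g(X,\varphi_iY),$$ where $d\eta(X,Y)=X(\eta(Y))-Y(\eta(X))-\eta([X,Y])$.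 Let $\nabla$ be the canonical connection, i.e. a metric connection with totally skew-symmetric torsion such that, for some smooth function $\beta$ and every even permutation $(i,j,k)$ of $(1,2,3)$, $$\nabla_X\varphi_i=\beta\,(\eta_k(X)\varphi_j-\eta_j(X)\varphi_k)\quad\text{for all vector fields }X.$$ Let $\mathrm{Ric}(X,Y)=\sum_a g(R(e_a,X)Y,e_a)$ be its Ricci tensor, where $(e_a)$ is an orthonormal frame and $R(X,Y)=[\nabla_X,\nabla_Y]-\nabla_{[X,Y]}$. Then $$\mathrm{Ric}=4\alpha\{\delta(n+2)-3\alpha\}\,g+4\alpha\{\delta(2-n)-5\alpha\}\sum_{i=1}^3\eta_i\otimes\eta_i =4\alpha\{\delta(n+2)-3\alpha\}\,g_{\mathcal H}+16\alpha(\delta-2\alpha)\,g_{\mathcal V},$$ where $g_{\mathcal H}(X,Y)=g(X_{\mathcal H},Y_{\mathcal H})$ and $g_{\mathcal V}(X,Y)=g(X_{\mathcal V},Y_{\mathcal V})$ for the components of $X,Y$ in the splitting $TM=\mathcal H\oplus\mathcal V$, $\mathcal H=\bigcap_i\ker\eta_i$, $\mathcal V=\langle\xi_1,\xi_2,\xi_3\rangle$.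 In particular, $M$ is $\nabla$-Einstein (the symmetric part of $\mathrm{Ric}$ equals $\frac{\mathrm{Scal}}{\dim M}\,g$, where $\mathrm{Scal}$ is the metric trace of $\mathrm{Ric}$) if and only if $\delta(2-n)=5\alpha$, and it is never $\nabla$-Ricci flat. -/

import Mathlib

open Bundle
open scoped Manifold ContDiff

noncomputable section

namespace ThreeSasaki

/-! Smooth `d`-manifolds are modelled on `EuclideanSpace ℝ (Fin d)` with the model `𝓡 d`; the
Riemannian metric `g` is the inner product of the tangent spaces given by `RiemannianBundle`. For a
connection `D`, the vector `D Y x u` is `(∇_u Y)(x)`. -/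

section Connections

variable {d : ℕ} {M : Type*} [TopologicalSpace M] [ChartedSpace (EuclideanSpace ℝ (Fin d)) M]

/-- The exterior derivative of a 1-form `η` on two vector fields,
`dη(X, Y) = X(η(Y)) - Y(η(X)) - η([X, Y])`. -/
def extDerivOneForm (η : Π x : M, TangentSpace (𝓡 d) x →L[ℝ] ℝ)
    (X Y : Π x : M, TangentSpace (𝓡 d) x) (x : M) : ℝ :=
  mvfderiv (𝓡 d) (fun y ↦ η y (Y y)) x (X x)
    - mvfderiv (𝓡 d) (fun y ↦ η y (X y)) x (Y x)
    - η x (VectorField.mlieBracket (𝓡 d) X Y x)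

/-- A linear connection (covariant derivative on the tangent bundle). -/
abbrev LinearConnection (d : ℕ) (M : Type*) [TopologicalSpace M]
    [ChartedSpace (EuclideanSpace ℝ (Fin d)) M] [IsManifold (𝓡 d) ∞ M] :=
  CovariantDerivative (𝓡 d) (EuclideanSpace ℝ (Fin d)) (TangentSpace (𝓡 d) : M → Type _)

variable [IsManifold (𝓡 d) ∞ M]

/-- The vector field `X` is differentiable at `x`, as a section of the tangent bundle. -/
abbrev IsDiffFieldAt (X : Π x : M, TangentSpace (𝓡 d) x) (x : M) : Prop :=
  MDifferentiableAt (𝓡 d) ((𝓡 d).prod 𝓘(ℝ, EuclideanSpace ℝ (Fin d)))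
    (fun y ↦ (⟨y, X y⟩ : TotalSpace (EuclideanSpace ℝ (Fin d)) (TangentSpace (𝓡 d) : M → Type _))) x

/-- The covariant derivative of a `(1,1)`-tensor field,
`(∇_X φ)Y = ∇_X (φ Y) - φ (∇_X Y)`. -/
def covEndo (D : LinearConnection d M)
    (φ : Π x : M, TangentSpace (𝓡 d) x →L[ℝ] TangentSpace (𝓡 d) x)
    (X Y : Π x : M, TangentSpace (𝓡 d) x) (x : M) : TangentSpace (𝓡 d) x :=
  D (fun y ↦ φ y (Y y)) x (X x) - φ x (D Y x (X x))

/-- The curvature on vector fields,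
`R(X, Y)Z = ∇_X ∇_Y Z - ∇_Y ∇_X Z - ∇_{[X, Y]} Z`. -/
def curvature (D : LinearConnection d M) (X Y Z : Π x : M, TangentSpace (𝓡 d) x) (x : M) :
    TangentSpace (𝓡 d) x :=
  D (fun y ↦ D Z y (Y y)) x (X x) - D (fun y ↦ D Z y (X y)) x (Y x)
    - D Z x (VectorField.mlieBracket (𝓡 d) X Y x)

/-- The curvature tensor at `x` on tangent vectors. Each vector is extended to a vector field that
is smooth near `x`; for a smooth connection the value does not depend on the extensions. -/
def curvatureAt (D : LinearConnection d M) (x : M) (u v w : TangentSpace (𝓡 d) x) :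
    TangentSpace (𝓡 d) x :=
  curvature D (FiberBundle.extend (EuclideanSpace ℝ (Fin d)) u)
    (FiberBundle.extend (EuclideanSpace ℝ (Fin d)) v)
    (FiberBundle.extend (EuclideanSpace ℝ (Fin d)) w) x

variable [RiemannianBundle (fun x : M ↦ TangentSpace (𝓡 d) x)]

instance (x : M) : FiniteDimensional ℝ (TangentSpace (𝓡 d) x) :=
  inferInstanceAs (FiniteDimensional ℝ (EuclideanSpace ℝ (Fin d)))

/-- The Ricci tensor of a connection, `Ric(u, v) = ∑_a g(R(e_a, u)v, e_a)` for an orthonormal basis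
`(e_a)` of the tangent space. -/
def ricci (D : LinearConnection d M) (x : M) (u v : TangentSpace (𝓡 d) x) : ℝ :=
  ∑ a, inner ℝ (curvatureAt D x (stdOrthonormalBasis ℝ (TangentSpace (𝓡 d) x) a) u v)
    (stdOrthonormalBasis ℝ (TangentSpace (𝓡 d) x) a)

/-- The scalar curvature of a connection, the metric trace of its Ricci tensor. -/
def scal (D : LinearConnection d M) (x : M) : ℝ :=
  ∑ a, ricci D x (stdOrthonormalBasis ℝ (TangentSpace (𝓡 d) x) a)
    (stdOrthonormalBasis ℝ (TangentSpace (𝓡 d) x) a)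

/-- `∇`-Einstein: the symmetric part of the Ricci tensor of `∇` is `(Scal / dim M) g`. -/
def IsNablaEinstein (D : LinearConnection d M) : Prop :=
  ∀ (x : M) (u v : TangentSpace (𝓡 d) x),
    (ricci D x u v + ricci D x v u) / 2 = scal D x / d * inner ℝ u v

/-- `∇`-Ricci flat: the Ricci tensor of `∇` vanishes identically. -/
def IsNablaRicciFlat (D : LinearConnection d M) : Prop :=
  ∀ (x : M) (u v : TangentSpace (𝓡 d) x), ricci D x u v = 0

instance [h : IsContMDiffRiemannianBundle (𝓡 d) ∞ (EuclideanSpace ℝ (Fin d))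
      (fun x : M ↦ TangentSpace (𝓡 d) x)] :
    IsContMDiffRiemannianBundle (𝓡 d) 1 (EuclideanSpace ℝ (Fin d))
      (fun x : M ↦ TangentSpace (𝓡 d) x) :=
  IsContMDiffRiemannianBundle.of_le (h := h) (by norm_cast)

/-- A smooth metric connection with totally skew-symmetric torsion: `g(T(u, v), w)` is a 3-form
(it is always skew-symmetric in `u, v`). -/
structure IsMetricWithSkewTorsion
    [IsContMDiffRiemannianBundle (𝓡 d) ∞ (EuclideanSpace ℝ (Fin d))
      (fun x : M ↦ TangentSpace (𝓡 d) x)]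
    (D : LinearConnection d M) : Prop where
  smooth : CovariantDerivative.ContMDiffCovariantDerivative D ∞
  metric : CovariantDerivative.IsMetricCompatible D
  skew : ∀ (x : M) (u v w : TangentSpace (𝓡 d) x),
    (inner ℝ (D.torsion x u v) w : ℝ) = - inner ℝ (D.torsion x u w) v

end Connections

section Structures

/-- An almost 3-contact metric structure `(φ_i, ξ_i, η_i, g)` on a `(4n+3)`-dimensional manifold
with Riemannian metric `g`. Indices live in `Fin 3`, so the even permutations of the three indices
are the triples `(i, i + 1, i + 2)`. -/
structure AlmostThreeContactMetric (n : ℕ) (M : Type*) [TopologicalSpace M]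
    [ChartedSpace (EuclideanSpace ℝ (Fin (4 * n + 3))) M] [IsManifold (𝓡 (4 * n + 3)) ∞ M]
    [RiemannianBundle (fun x : M ↦ TangentSpace (𝓡 (4 * n + 3)) x)] where
  φ : Fin 3 → Π x : M, TangentSpace (𝓡 (4 * n + 3)) x →L[ℝ] TangentSpace (𝓡 (4 * n + 3)) x
  ξ : Fin 3 → Π x : M, TangentSpace (𝓡 (4 * n + 3)) x
  η : Fin 3 → Π x : M, TangentSpace (𝓡 (4 * n + 3)) x →L[ℝ] ℝ
  smooth_φ : ∀ i, ContMDiff (𝓡 (4 * n + 3))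
    ((𝓡 (4 * n + 3)).prod
      𝓘(ℝ, EuclideanSpace ℝ (Fin (4 * n + 3)) →L[ℝ] EuclideanSpace ℝ (Fin (4 * n + 3)))) ∞
    (fun x ↦ Bundle.TotalSpace.mk'
      (EuclideanSpace ℝ (Fin (4 * n + 3)) →L[ℝ] EuclideanSpace ℝ (Fin (4 * n + 3)))
      (E := fun x : M ↦ TangentSpace (𝓡 (4 * n + 3)) x →L[ℝ] TangentSpace (𝓡 (4 * n + 3)) x)
      x (φ i x))
  smooth_ξ : ∀ i, ContMDiff (𝓡 (4 * n + 3))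
    ((𝓡 (4 * n + 3)).prod 𝓘(ℝ, EuclideanSpace ℝ (Fin (4 * n + 3)))) ∞
    (fun x ↦ Bundle.TotalSpace.mk' (EuclideanSpace ℝ (Fin (4 * n + 3)))
      (E := fun x : M ↦ TangentSpace (𝓡 (4 * n + 3)) x) x (ξ i x))
  smooth_η : ∀ i, ContMDiff (𝓡 (4 * n + 3))
    ((𝓡 (4 * n + 3)).prod 𝓘(ℝ, EuclideanSpace ℝ (Fin (4 * n + 3)) →L[ℝ] ℝ)) ∞
    (fun x ↦ Bundle.TotalSpace.mk' (EuclideanSpace ℝ (Fin (4 * n + 3)) →L[ℝ] ℝ)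
      (E := fun x : M ↦ TangentSpace (𝓡 (4 * n + 3)) x →L[ℝ] ℝ) x (η i x))
  -- each `(φ_i, ξ_i, η_i)` is an almost contact structure
  φ_sq : ∀ i x v, φ i x (φ i x v) = - v + η i x v • ξ i x
  η_ξ : ∀ i x, η i x (ξ i x) = 1
  -- the compatibility relations between the three structures
  φ_eq : ∀ i x v, φ (i + 2) x v = φ i x (φ (i + 1) x v) - η (i + 1) x v • ξ i x
  φ_eq' : ∀ i x v, φ (i + 2) x v = - φ (i + 1) x (φ i x v) + η i x v • ξ (i + 1) x
  ξ_eq : ∀ i x, ξ (i + 2) x = φ i x (ξ (i + 1) x)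
  ξ_eq' : ∀ i x, ξ (i + 2) x = - φ (i + 1) x (ξ i x)
  η_eq : ∀ i x v, η (i + 2) x v = η i x (φ (i + 1) x v)
  η_eq' : ∀ i x v, η (i + 2) x v = - η (i + 1) x (φ i x v)
  -- the metric is compatible with each of them
  compatible : ∀ i x u v,
    (inner ℝ (φ i x u) (φ i x v) : ℝ) = inner ℝ u v - η i x u * η i x v

variable {n : ℕ} {M : Type*} [TopologicalSpace M]
  [ChartedSpace (EuclideanSpace ℝ (Fin (4 * n + 3))) M] [IsManifold (𝓡 (4 * n + 3)) ∞ M]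
  [RiemannianBundle (fun x : M ↦ TangentSpace (𝓡 (4 * n + 3)) x)]

namespace AlmostThreeContactMetric

/-- The fundamental 2-forms `Φ_i(u, v) = g(u, φ_i v)`. -/
def Φ (S : AlmostThreeContactMetric n M) (i : Fin 3) (x : M)
    (u v : TangentSpace (𝓡 (4 * n + 3)) x) : ℝ :=
  inner ℝ u (S.φ i x v)

/-- The projection of a tangent vector to `𝒱 = ⟨ξ₁, ξ₂, ξ₃⟩` along `ℋ = ⋂ ker η_i`. -/
def vert (S : AlmostThreeContactMetric n M) (x : M) (u : TangentSpace (𝓡 (4 * n + 3)) x) :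
    TangentSpace (𝓡 (4 * n + 3)) x :=
  ∑ i, S.η i x u • S.ξ i x

/-- The projection of a tangent vector to `ℋ = ⋂ ker η_i` along `𝒱`. -/
def hor (S : AlmostThreeContactMetric n M) (x : M) (u : TangentSpace (𝓡 (4 * n + 3)) x) :
    TangentSpace (𝓡 (4 * n + 3)) x :=
  u - S.vert x u

/-- The 3-(α,δ)-Sasaki condition: `α ≠ 0` and
`dη_i = 2α Φ_i + 2(α - δ) η_j ∧ η_k` for every even permutation `(i, j, k)`. Both sides are tensors,
so the equation is stated at `x` for all vector fields differentiable at `x`. -/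
structure IsThreeSasaki (S : AlmostThreeContactMetric n M) (α δ : ℝ) : Prop where
  α_ne_zero : α ≠ 0
  extDeriv_η : ∀ (i : Fin 3) (X Y : Π x : M, TangentSpace (𝓡 (4 * n + 3)) x) (x : M),
    IsDiffFieldAt X x → IsDiffFieldAt Y x →
    extDerivOneForm (S.η i) X Y x =
      2 * α * S.Φ i x (X x) (Y x)
        + 2 * (α - δ) * (S.η (i + 1) x (X x) * S.η (i + 2) x (Y x)
            - S.η (i + 2) x (X x) * S.η (i + 1) x (Y x))

/-- The canonical connection: a metric connection with skew torsion such that, for some smooth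
function `β`, `∇_X φ_i = β (η_k(X) φ_j - η_j(X) φ_k)` for every even permutation `(i, j, k)`.
Both sides are tensors, so the equation is stated at `x` for all vector fields differentiable
at `x`. -/
structure IsCanonicalConnection
    [IsContMDiffRiemannianBundle (𝓡 (4 * n + 3)) ∞ (EuclideanSpace ℝ (Fin (4 * n + 3)))
      (fun x : M ↦ TangentSpace (𝓡 (4 * n + 3)) x)]
    (S : AlmostThreeContactMetric n M) (D : LinearConnection (4 * n + 3) M) : Prop where
  metric_skew : IsMetricWithSkewTorsion D
  canonical : ∃ β : M → ℝ, ContMDiff (𝓡 (4 * n + 3)) 𝓘(ℝ, ℝ) ∞ β ∧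
    ∀ (i : Fin 3) (X Y : Π x : M, TangentSpace (𝓡 (4 * n + 3)) x) (x : M),
      IsDiffFieldAt X x → IsDiffFieldAt Y x →
      covEndo D (S.φ i) X Y x =
        β x • (S.η (i + 2) x (X x) • S.φ (i + 1) x (Y x)
          - S.η (i + 1) x (X x) • S.φ (i + 2) x (Y x))

end AlmostThreeContactMetric

end Structures

end ThreeSasaki

end

/-! The whole computation reduces to algebra in one tangent space, with `(i, j, k)` an even
permutation. The condition on `∇φ_i` says that `∇` moves the triples `φ`, `ξ`, `η` by one
infinitesimal rotation, with coefficients `β η_l`. So `∇ξ_i` and `∇η_i` are known, and comparison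
with `dη_i` gives the vertical component `η_i(T)` of the torsion. The identity `d(dη_i) = 0`
supplies the rest: it forces `β = 2δ - 4α` (`IsTorsion.eq_beta`) and kills `T` on horizontal triples
(`IsTorsion.inner_horizontal`). Thus `T` is explicit (`IsTorsion.eq_canonicalTorsion`).

This `T` is invariant under the rotations, hence parallel (`nab_tors`). The first Bianchi identity
then expresses the cyclic sum of `R` through a 4-form quadratic in `T`, which gives pair symmetry.
Differentiating the rotation gives `[R(X,Y), φ_i] = F_k(X,Y) φ_j - F_j(X,Y) φ_k` (`curv_φf`).

For Ricci, the arguments `v = ξ_i` follow directly from `R(X,Y)ξ_i`. A horizontal `v` is written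
`φ_i y`, and the commutator moves `φ_i` onto the frame vector (`IsCurvature.sum_apply_φ_self`). In
the resulting Bianchi sum two terms agree by pair symmetry, and the third is the trace of `R(u,y)`
against `φ_i`, a multiple of `F_i` by the quaternionic relations (`IsCurvature.sum_apply_self_φ`).
The Einstein and Ricci-flat claims compare the horizontal and vertical coefficients. -/

noncomputable section

namespace ThreeSasaki

open Module

/-! ### Linear algebra of almost 3-contact metric structures -/

theorem fin_three_add_two_add_one (i : Fin 3) : i + 2 + 1 = i := by
  fin_cases i <;> rfl

theorem fin_three_add_one_add_two (i : Fin 3) : i + 1 + 2 = i := by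
  fin_cases i <;> rfl

theorem fin_three_add_two_add_two (i : Fin 3) : i + 2 + 2 = i + 1 := by
  fin_cases i <;> rfl

theorem fin_three_add_one_add_one (i : Fin 3) : i + 1 + 1 = i + 2 := by
  fin_cases i <;> rfl

theorem sum_fin_three_cyclic {A : Type*} [AddCommMonoid A] (f : Fin 3 → A) (i : Fin 3) :
    ∑ l, f l = f i + f (i + 1) + f (i + 2) := by
  fin_cases i <;> simp [Fin.sum_univ_three] <;> abel

/-- The pointwise data of an almost 3-contact metric structure on a Euclidean vector space. -/
structure ThreeContactSpace (V : Type*) [NormedAddCommGroup V] [InnerProductSpace ℝ V] where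
  φ : Fin 3 → V →L[ℝ] V
  ξ : Fin 3 → V
  η : Fin 3 → V →L[ℝ] ℝ
  φ_sq : ∀ i v, φ i (φ i v) = - v + η i v • ξ i
  η_ξ : ∀ i, η i (ξ i) = 1
  φ_eq : ∀ i v, φ (i + 2) v = φ i (φ (i + 1) v) - η (i + 1) v • ξ i
  φ_eq' : ∀ i v, φ (i + 2) v = - φ (i + 1) (φ i v) + η i v • ξ (i + 1)
  ξ_eq : ∀ i, ξ (i + 2) = φ i (ξ (i + 1))
  ξ_eq' : ∀ i, ξ (i + 2) = - φ (i + 1) (ξ i)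
  η_eq : ∀ i v, η (i + 2) v = η i (φ (i + 1) v)
  η_eq' : ∀ i v, η (i + 2) v = - η (i + 1) (φ i v)
  compatible : ∀ i u v, (inner ℝ (φ i u) (φ i v) : ℝ) = inner ℝ u v - η i u * η i v

namespace ThreeContactSpace

variable {V : Type*} [NormedAddCommGroup V] [InnerProductSpace ℝ V] (S : ThreeContactSpace V)

/-- Since `φ_i² ξ_i = 0`, the formula for `φ_i²` at `φ_i ξ_i` gives `φ_i ξ_i = c ξ_i`. Applying
`φ_i` again gives `c φ_i ξ_i = 0`. -/
theorem φ_ξ (i : Fin 3) : S.φ i (S.ξ i) = 0 := by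
  have h0 : S.φ i (S.φ i (S.ξ i)) = 0 := by simp [S.φ_sq, S.η_ξ]
  have h1 : S.φ i (S.ξ i) = S.η i (S.φ i (S.ξ i)) • S.ξ i := by
    have := S.φ_sq i (S.φ i (S.ξ i))
    rw [h0, map_zero] at this
    exact (neg_add_eq_zero.mp this.symm)
  have h2 := congrArg (S.φ i) h1
  rw [h0, map_smul] at h2
  rcases smul_eq_zero.mp h2.symm with h | h
  · rw [h1, h, zero_smul]
  · exact h

theorem η_φ (i : Fin 3) (v : V) : S.η i (S.φ i v) = 0 := by
  have h1 := S.φ_sq i (S.φ i v)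
  have h2 := congrArg (S.φ i) (S.φ_sq i v)
  rw [h1, map_add, map_neg, map_smul, S.φ_ξ, smul_zero, add_zero] at h2
  have h3 : S.η i (S.φ i v) • S.ξ i = 0 := by simpa using h2
  have := congrArg (S.η i) h3
  simpa [S.η_ξ] using this

theorem inner_ξ (i : Fin 3) (v : V) : (inner ℝ v (S.ξ i) : ℝ) = S.η i v := by
  have := S.compatible i v (S.ξ i)
  rw [S.φ_ξ, inner_zero_right, S.η_ξ] at this
  linarith

theorem inner_ξ' (i : Fin 3) (v : V) : (inner ℝ (S.ξ i) v : ℝ) = S.η i v := by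
  rw [real_inner_comm, S.inner_ξ]

theorem inner_φ_left (i : Fin 3) (u v : V) :
    (inner ℝ (S.φ i u) v : ℝ) = - inner ℝ u (S.φ i v) := by
  have := S.compatible i u (S.φ i v)
  rw [S.φ_sq, S.η_φ, inner_add_right, inner_neg_right, inner_smul_right, S.inner_ξ, S.η_φ] at this
  linarith

theorem inner_φ_self (i : Fin 3) (u : V) : (inner ℝ u (S.φ i u) : ℝ) = 0 := by
  have := S.inner_φ_left i u u
  rw [real_inner_comm] at this
  linarith

theorem φ_ξ_one (i : Fin 3) : S.φ i (S.ξ (i + 1)) = S.ξ (i + 2) := (S.ξ_eq i).symm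

theorem φ_ξ_two (i : Fin 3) : S.φ i (S.ξ (i + 2)) = - S.ξ (i + 1) := by
  have := S.ξ_eq' (i + 2)
  rw [fin_three_add_two_add_two, fin_three_add_two_add_one] at this
  rw [this, neg_neg]

theorem φ_one_ξ (i : Fin 3) : S.φ (i + 1) (S.ξ i) = - S.ξ (i + 2) := by
  rw [S.ξ_eq' i, neg_neg]

theorem φ_two_ξ (i : Fin 3) : S.φ (i + 2) (S.ξ i) = S.ξ (i + 1) := by
  have := S.ξ_eq (i + 2)
  rw [fin_three_add_two_add_two, fin_three_add_two_add_one] at this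
  exact this.symm

theorem φ_one_ξ_two (i : Fin 3) : S.φ (i + 1) (S.ξ (i + 2)) = S.ξ i := by
  have := S.φ_ξ_one (i + 1)
  rwa [fin_three_add_one_add_one, fin_three_add_one_add_two] at this

theorem φ_two_ξ_one (i : Fin 3) : S.φ (i + 2) (S.ξ (i + 1)) = - S.ξ i := by
  have := S.φ_ξ_two (i + 2)
  rwa [fin_three_add_two_add_one, fin_three_add_two_add_two] at this

theorem η_φ_one (i : Fin 3) (v : V) : S.η i (S.φ (i + 1) v) = S.η (i + 2) v := (S.η_eq i v).symm

theorem η_φ_two (i : Fin 3) (v : V) : S.η i (S.φ (i + 2) v) = - S.η (i + 1) v := by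
  have := S.η_eq' (i + 2) v
  rw [fin_three_add_two_add_two, fin_three_add_two_add_one] at this
  rw [this, neg_neg]

theorem η_one_φ (i : Fin 3) (v : V) : S.η (i + 1) (S.φ i v) = - S.η (i + 2) v := by
  rw [S.η_eq' i, neg_neg]

theorem η_two_φ (i : Fin 3) (v : V) : S.η (i + 2) (S.φ i v) = S.η (i + 1) v := by
  have := S.η_eq (i + 2) v
  rw [fin_three_add_two_add_two, fin_three_add_two_add_one] at this
  exact this.symm

theorem η_ξ_two (i : Fin 3) : S.η i (S.ξ (i + 2)) = 0 := by
  rw [S.ξ_eq, S.η_φ]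

theorem η_two_ξ (i : Fin 3) : S.η (i + 2) (S.ξ i) = 0 := by
  rw [← S.inner_ξ, real_inner_comm, S.inner_ξ, S.η_ξ_two]

theorem η_ξ_one (i : Fin 3) : S.η i (S.ξ (i + 1)) = 0 := by
  have := S.η_two_ξ (i + 1)
  rwa [fin_three_add_one_add_two] at this

theorem η_one_ξ (i : Fin 3) : S.η (i + 1) (S.ξ i) = 0 := by
  rw [← S.inner_ξ, real_inner_comm, S.inner_ξ, S.η_ξ_one]

theorem η_two_ξ_one (i : Fin 3) : S.η (i + 2) (S.ξ (i + 1)) = 0 := by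
  have := S.η_one_ξ (i + 1)
  rwa [fin_three_add_one_add_one] at this

theorem φ_φ_one (i : Fin 3) (v : V) :
    S.φ i (S.φ (i + 1) v) = S.φ (i + 2) v + S.η (i + 1) v • S.ξ i := by
  rw [S.φ_eq i]; abel

theorem φ_one_φ (i : Fin 3) (v : V) :
    S.φ (i + 1) (S.φ i v) = - S.φ (i + 2) v + S.η i v • S.ξ (i + 1) := by
  rw [S.φ_eq' i]; abel

theorem φ_φ_two (i : Fin 3) (v : V) :
    S.φ i (S.φ (i + 2) v) = - S.φ (i + 1) v + S.η (i + 2) v • S.ξ i := by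
  have := S.φ_one_φ (i + 2) v
  rwa [fin_three_add_two_add_one, fin_three_add_two_add_two] at this

theorem φ_two_φ (i : Fin 3) (v : V) :
    S.φ (i + 2) (S.φ i v) = S.φ (i + 1) v + S.η i v • S.ξ (i + 2) := by
  have := S.φ_φ_one (i + 2) v
  rwa [fin_three_add_two_add_one, fin_three_add_two_add_two] at this

theorem φ_one_φ_two (i : Fin 3) (v : V) :
    S.φ (i + 1) (S.φ (i + 2) v) = S.φ i v + S.η (i + 2) v • S.ξ (i + 1) := by
  have := S.φ_φ_one (i + 1) v
  rwa [fin_three_add_one_add_one, fin_three_add_one_add_two] at this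

theorem φ_two_φ_one (i : Fin 3) (v : V) :
    S.φ (i + 2) (S.φ (i + 1) v) = - S.φ i v + S.η (i + 1) v • S.ξ (i + 2) := by
  have := S.φ_one_φ (i + 1) v
  rwa [fin_three_add_one_add_one, fin_three_add_one_add_two] at this

/-- The horizontal part of a vector. -/
def hor (u : V) : V := u - ∑ i, S.η i u • S.ξ i

theorem η_hor (i : Fin 3) (u : V) : S.η i (S.hor u) = 0 := by
  simp [hor, sum_fin_three_cyclic _ i, S.η_ξ, S.η_ξ_one, S.η_ξ_two]

theorem hor_add (u : V) : S.hor u + ∑ i, S.η i u • S.ξ i = u := by simp [hor]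

theorem η_φ_hor (i l : Fin 3) {u : V} (hu : ∀ i, S.η i u = 0) : S.η l (S.φ i u) = 0 := by
  obtain rfl | rfl | rfl : l = i ∨ l = i + 1 ∨ l = i + 2 := by
    fin_cases i <;> fin_cases l <;> simp
  · exact S.η_φ _ u
  · rw [S.η_one_φ, hu, neg_zero]
  · rw [S.η_two_φ, hu]

theorem exists_horizontal_ne_zero [FiniteDimensional ℝ V] (h : 3 < finrank ℝ V) :
    ∃ u : V, (∀ i, S.η i u = 0) ∧ u ≠ 0 := by
  let f : V →ₗ[ℝ] (Fin 3 → ℝ) := LinearMap.pi fun i ↦ (S.η i : V →ₗ[ℝ] ℝ)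
  have hf : LinearMap.ker f ≠ ⊥ := LinearMap.ker_ne_bot_of_finrank_lt (by simpa using h)
  obtain ⟨u, hu, hu0⟩ := Submodule.exists_mem_ne_zero_of_ne_bot hf
  exact ⟨u, fun i ↦ congrFun (LinearMap.mem_ker.mp hu) i, hu0⟩

/-- The fundamental form `Φ_i`. -/
def Φ (i : Fin 3) (u v : V) : ℝ := inner ℝ u (S.φ i v)

/-- The 2-form `η_j ∧ η_k` for `(i, j, k)` an even permutation. -/
def ηη (i : Fin 3) (u v : V) : ℝ := S.η (i + 1) u * S.η (i + 2) v - S.η (i + 2) u * S.η (i + 1) v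

/-- The torsion tensor of the canonical connection. -/
def canonicalTorsion (α δ : ℝ) (u v : V) : V :=
  ∑ l, ((2 * α * S.Φ l u v + 2 * (δ - α) * S.ηη l u v) • S.ξ l
    + (2 * α) • (S.η l v • S.φ l u - S.η l u • S.φ l v))

/-- The exterior derivatives of the `η_i`. -/
def dη (α δ : ℝ) (i : Fin 3) (u v : V) : ℝ := 2 * α * S.Φ i u v + 2 * (α - δ) * S.ηη i u v

theorem Φ_swap (i : Fin 3) (u v : V) : S.Φ i u v = - S.Φ i v u := by
  rw [Φ, Φ, real_inner_comm, S.inner_φ_left]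

theorem ηη_swap (i : Fin 3) (u v : V) : S.ηη i u v = - S.ηη i v u := by
  rw [ηη, ηη]; ring

theorem canonicalTorsion_swap (α δ : ℝ) (u v : V) :
    S.canonicalTorsion α δ u v = - S.canonicalTorsion α δ v u := by
  rw [canonicalTorsion, canonicalTorsion, ← Finset.sum_neg_distrib]
  refine Finset.sum_congr rfl fun l _ ↦ ?_
  rw [S.Φ_swap l v u, S.ηη_swap l v u]
  module

theorem inner_canonicalTorsion (α δ : ℝ) (u v w : V) :
    (inner ℝ (S.canonicalTorsion α δ u v) w : ℝ) =
      ∑ l, ((2 * α * S.Φ l u v + 2 * (δ - α) * S.ηη l u v) * S.η l w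
        + (2 * α) * (S.η l v * S.Φ l w u - S.η l u * S.Φ l w v)) := by
  rw [canonicalTorsion, sum_inner]
  refine Finset.sum_congr rfl fun l _ ↦ ?_
  rw [real_inner_comm]
  simp only [inner_add_right, inner_sub_right, real_inner_smul_right, S.inner_ξ, Φ]

/-- The trilinear form is `2α ∑ η_l ∧ Φ_l + 2(δ - α) η_1 ∧ η_2 ∧ η_3`, where `∑ ηη_l(u,v) η_l(w)` is
the expansion of a 3×3 determinant. -/
theorem inner_canonicalTorsion_skew (α δ : ℝ) (u v w : V) :
    (inner ℝ (S.canonicalTorsion α δ u v) w : ℝ) = - inner ℝ (S.canonicalTorsion α δ u w) v := by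
  simp only [inner_canonicalTorsion, sum_fin_three_cyclic _ 0, ηη, S.Φ_swap _ w, S.Φ_swap _ v u,
    fin_three_add_one_add_one, fin_three_add_one_add_two, fin_three_add_two_add_one,
    fin_three_add_two_add_two]
  ring

theorem Φ_ξ (i l : Fin 3) (u : V) : S.Φ i u (S.ξ l) = - S.η l (S.φ i u) := by
  rw [Φ, ← neg_inj, ← S.inner_φ_left, S.inner_ξ, neg_neg]

/-- The coefficient `2δ - 6α` is `2(α - δ) + 2β` at `β = 2δ - 4α`, in agreement with
`IsTorsion.η_apply`. -/
theorem η_canonicalTorsion (α δ : ℝ) (i : Fin 3) (u v : V) :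
    S.η i (S.canonicalTorsion α δ u v) = 2 * α * S.Φ i u v + (2 * δ - 6 * α) * S.ηη i u v := by
  rw [← S.inner_ξ, inner_canonicalTorsion, sum_fin_three_cyclic _ i]
  simp only [S.Φ_swap _ (S.ξ i), Φ_ξ, S.η_φ, S.η_φ_one, S.η_φ_two, S.η_ξ, S.η_one_ξ, S.η_two_ξ, ηη]
  ring

end ThreeContactSpace

end ThreeSasaki

/-! ### Algebraic determination of `β` and of the torsion -/

namespace ThreeSasaki

open Module

namespace ThreeContactSpace

variable {V : Type*} [NormedAddCommGroup V] [InnerProductSpace ℝ V] (S : ThreeContactSpace V)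

/-- The algebraic properties of the torsion `T` of a canonical connection with function value `β`:
it is a 3-form, its vertical part is prescribed by `dη_i`, and `d(dη_i) = 0`. -/
structure IsTorsion (α δ β : ℝ) (T : V →L[ℝ] V →L[ℝ] V) : Prop where
  swap : ∀ u v, T u v = - T v u
  skew : ∀ u v w, (inner ℝ (T u v) w : ℝ) = - inner ℝ (T u w) v
  η_apply : ∀ i u v, S.η i (T u v) = S.dη α δ i u v + 2 * β * S.ηη i u v
  closed : ∀ i u v w,
    (β * (S.η (i + 2) u * S.dη α δ (i + 1) v w - S.η (i + 1) u * S.dη α δ (i + 2) v w)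
        + S.dη α δ i (T u v) w)
      + (β * (S.η (i + 2) v * S.dη α δ (i + 1) w u - S.η (i + 1) v * S.dη α δ (i + 2) w u)
        + S.dη α δ i (T v w) u)
      + (β * (S.η (i + 2) w * S.dη α δ (i + 1) u v - S.η (i + 1) w * S.dη α δ (i + 2) u v)
        + S.dη α δ i (T w u) v) = 0

variable {S} {α δ β : ℝ} {T : V →L[ℝ] V →L[ℝ] V}

theorem IsTorsion.inner_ξ_left (hT : S.IsTorsion α δ β T) (i : Fin 3) (v w : V) :
    (inner ℝ (T (S.ξ i) v) w : ℝ) = S.η i (T v w) := by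
  rw [hT.swap, inner_neg_left, hT.skew, neg_neg, S.inner_ξ]

theorem IsTorsion.inner_ξ_mid (hT : S.IsTorsion α δ β T) (i : Fin 3) (v w : V) :
    (inner ℝ (T v (S.ξ i)) w : ℝ) = - S.η i (T v w) := by
  rw [hT.skew, S.inner_ξ]

/-- Closedness of `dη_i` with one vertical and two horizontal arguments involves only known
components of `T` and is linear in `β`. The dimension bound provides a nonzero horizontal vector. -/
theorem IsTorsion.eq_beta [FiniteDimensional ℝ V] (hT : S.IsTorsion α δ β T) (hα : α ≠ 0)
    (hV : 3 < finrank ℝ V) : β = 2 * δ - 4 * α := by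
  obtain ⟨X, hX, hX0⟩ := S.exists_horizontal_ne_zero hV
  have hφ : ∀ i l, S.η l (S.φ i X) = 0 := fun i l ↦ S.η_φ_hor i l hX
  have hφφ : ∀ i m l, S.η l (S.φ m (S.φ i X)) = 0 := fun i m l ↦ S.η_φ_hor m l (hφ i)
  -- The vector `ξ_{i+1}` leaves a single `β` term, `-β dη_{i+2}(X, φ_{i+2} X) = 2αβ |X|²`, which
  -- the choice of third argument makes nonzero. The three torsion terms add up to `(8α² - 4αδ)
  -- |X|²`.
  have key := hT.closed 0 (S.ξ (0 + 1)) X (S.φ (0 + 2) X)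
  have hXX : (inner ℝ X X : ℝ) ≠ 0 := by simpa using hX0
  have h1 : ∀ Y Z, (∀ i, S.η i Y = 0) → (∀ i, S.η i Z = 0) → ∀ i,
      S.η i (T Y Z) = 2 * α * S.Φ i Y Z := by
    intro Y Z hY hZ i
    rw [hT.η_apply]; simp [dη, ηη, hY]
  have e1 : S.dη α δ 0 (T (S.ξ (0 + 1)) X) (S.φ (0 + 2) X)
      = - (4 * α ^ 2 * inner ℝ X X) * (-1) := by
    simp only [dη, ηη, hφ, Φ, mul_zero, sub_zero, add_zero]
    rw [hT.inner_ξ_left, h1 _ _ hX (hφφ _ _), Φ, S.φ_one_φ, hφ, S.φ_sq, hX]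
    simp
    ring
  have e2 : S.dη α δ 0 (T X (S.φ (0 + 2) X)) (S.ξ (0 + 1)) = - 4 * α * δ * inner ℝ X X := by
    simp only [dη, ηη, Φ_ξ, S.η_one_φ, S.η_two_ξ_one, S.η_ξ, h1 _ _ hX (hφ _)]
    rw [Φ, S.φ_sq, hX]
    simp
    ring
  have e3 : S.dη α δ 0 (T (S.φ (0 + 2) X) (S.ξ (0 + 1))) X = 4 * α ^ 2 * inner ℝ X X := by
    simp only [dη, ηη, hX, Φ, mul_zero, sub_zero, add_zero]
    rw [hT.inner_ξ_mid, h1 _ _ (hφ _) (hφ _), Φ, S.φ_one_φ, hX, inner_add_right, inner_neg_right,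
      S.compatible, hX]
    simp
    ring
  rw [e1, e2, e3] at key
  have e4 : S.dη α δ (0 + 2) X (S.φ (0 + 2) X) = - (2 * α * inner ℝ X X) := by
    simp only [dη, ηη, hX, Φ, S.φ_sq]
    simp
  rw [e4] at key
  simp only [hX, hφ, S.η_two_ξ_one, S.η_ξ] at key
  have : (2 * α * inner ℝ X X) * (β - (2 * δ - 4 * α)) = 0 := by linarith
  rcases mul_eq_zero.mp this with h | h
  · exact absurd h (by positivity)
  · linarith

/-- On horizontal vectors `d(dη_0) = 0` says that `φ_0`, acting as a derivation, annihilates the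
3-form `T`. As `φ_0` is a complex structure there, this derivation is injective on 3-forms: its
eigenvalues on type `(p, q)` are `±i(p - q)`, with `p + q` odd. -/
theorem IsTorsion.inner_horizontal (hT : S.IsTorsion α δ β T) (hα : α ≠ 0) {u v w : V}
    (hu : ∀ i, S.η i u = 0) (hv : ∀ i, S.η i v = 0) (hw : ∀ i, S.η i w = 0) :
    (inner ℝ (T u v) w : ℝ) = 0 := by
  have key : ∀ {u v w : V}, (∀ i, S.η i u = 0) → (∀ i, S.η i v = 0) → (∀ i, S.η i w = 0) →
      (inner ℝ (T u v) (S.φ 0 w) : ℝ) + inner ℝ (T u (S.φ 0 v)) w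
        + inner ℝ (T (S.φ 0 u) v) w = 0 := by
    intro u v w hu hv hw
    have h := hT.closed 0 u v w
    simp only [dη, ηη, hu, hv, hw, Φ] at h
    have h2 : (2 * α) * ((inner ℝ (T u v) (S.φ 0 w) : ℝ) + inner ℝ (T v w) (S.φ 0 u)
      + inner ℝ (T w u) (S.φ 0 v)) = 0 := by linarith
    have h3 := (mul_eq_zero.mp h2).resolve_left (by positivity)
    rw [hT.skew u (S.φ 0 v), ← inner_neg_left, ← hT.swap, hT.swap (S.φ 0 u), inner_neg_left,
      hT.skew v, neg_neg]
    linarith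
  have hφ : ∀ {u : V}, (∀ i, S.η i u = 0) → ∀ l, S.η l (S.φ 0 u) = 0 := fun hu l ↦
    S.η_φ_hor 0 l hu
  have hsq : ∀ {u : V}, (∀ i, S.η i u = 0) → S.φ 0 (S.φ 0 u) = - u := fun hu ↦ by
    simp [S.φ_sq, hu]
  -- An elementary form of the eigenvalue argument: `key` with `φ_0` inserted in each slot is a
  -- linear system for the three ways of inserting `φ_0` twice. Using the result twice gives `T =
  -- T/4`, because `φ_0² = -1`.
  have half : ∀ {u v w : V}, (∀ i, S.η i u = 0) → (∀ i, S.η i v = 0) → (∀ i, S.η i w = 0) →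
      (inner ℝ (T (S.φ 0 u) (S.φ 0 v)) w : ℝ) = inner ℝ (T u v) w / 2 := by
    intro u v w hu hv hw
    have a := key (hφ hu) hv hw
    have b := key hu (hφ hv) hw
    have c := key hu hv (hφ hw)
    rw [hsq hu] at a
    rw [hsq hv] at b
    rw [hsq hw] at c
    simp only [map_neg, neg_apply, inner_neg_left, inner_neg_right] at a b c
    linarith
  have h1 := half hu hv hw
  have h2 := half (hφ hu) (hφ hv) hw
  rw [hsq hu, hsq hv] at h2
  simp only [map_neg, neg_apply, neg_neg] at h2
  linarith

theorem IsTorsion.eq_canonicalTorsion [FiniteDimensional ℝ V] (hT : S.IsTorsion α δ β T)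
    (hα : α ≠ 0) (hV : 3 < finrank ℝ V) (u v : V) : T u v = S.canonicalTorsion α δ u v := by
  have hβ := hT.eq_beta hα hV
  -- the two 3-forms agree as soon as one argument is vertical
  have hη : ∀ i u v, S.η i (T u v) = S.η i (S.canonicalTorsion α δ u v) := by
    intro i u v
    rw [hT.η_apply, η_canonicalTorsion, dη, hβ]; ring
  have red : ∀ u v w, (inner ℝ (T u v) w : ℝ) - inner ℝ (S.canonicalTorsion α δ u v) w =
      inner ℝ (T u v) (S.hor w) - inner ℝ (S.canonicalTorsion α δ u v) (S.hor w) := by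
    intro u v w
    conv_lhs => rw [← S.hor_add w]
    simp only [inner_add_right, inner_sum, inner_smul_right, S.inner_ξ, hη]
    ring
  have skew : ∀ u v w, (inner ℝ (T u v) w : ℝ) - inner ℝ (S.canonicalTorsion α δ u v) w =
      - (inner ℝ (T u w) v - inner ℝ (S.canonicalTorsion α δ u w) v) := by
    intro u v w
    rw [hT.skew, S.inner_canonicalTorsion_skew]; ring
  have swap : ∀ u v w, (inner ℝ (T u v) w : ℝ) - inner ℝ (S.canonicalTorsion α δ u v) w =
      - (inner ℝ (T v u) w - inner ℝ (S.canonicalTorsion α δ v u) w) := by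
    intro u v w
    rw [hT.swap, S.canonicalTorsion_swap, inner_neg_left, inner_neg_left]; ring
  refine ext_inner_right ℝ fun w ↦ sub_eq_zero.mp ?_
  -- The difference of the two 3-forms is unchanged when each argument is replaced by its horizontal
  -- part. On horizontal triples both vanish, every term of the canonical one containing a factor
  -- `η_l`.
  rw [red, skew, red, swap, skew, red, hT.inner_horizontal hα (fun i ↦ S.η_hor i _)
    (fun i ↦ S.η_hor i _) (fun i ↦ S.η_hor i _), inner_canonicalTorsion]
  simp [S.η_hor]

end ThreeContactSpace

end ThreeSasaki

/-! ### Frame contractions and symmetries of the curvature -/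

namespace ThreeSasaki

open Module

section Traces

variable {V ι : Type*} [NormedAddCommGroup V] [InnerProductSpace ℝ V] [Fintype ι]

theorem sum_inner_mul_apply (e : OrthonormalBasis ι ℝ V) (f : V →ₗ[ℝ] ℝ) (x : V) :
    ∑ a, (inner ℝ x (e a) : ℝ) * f (e a) = f x := by
  conv_rhs => rw [← e.sum_repr' x]
  simp only [map_sum, map_smul, smul_eq_mul, real_inner_comm x]

theorem sum_skew_apply (e : OrthonormalBasis ι ℝ V) (B : V →ₗ[ℝ] V →ₗ[ℝ] ℝ) (A : V →L[ℝ] V)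
    (hA : ∀ u v, (inner ℝ (A u) v : ℝ) = - inner ℝ u (A v)) :
    ∑ a, B (A (e a)) (e a) = - ∑ a, B (e a) (A (e a)) := by
  have h1 : ∀ a, B (A (e a)) (e a) = ∑ b, (inner ℝ (A (e a)) (e b) : ℝ) * B (e b) (e a) :=
    fun a ↦ (sum_inner_mul_apply e (B.flip (e a)) (A (e a))).symm
  have h2 : ∀ a, B (e a) (A (e a)) = ∑ b, (inner ℝ (A (e a)) (e b) : ℝ) * B (e a) (e b) :=
    fun a ↦ (sum_inner_mul_apply e (B (e a)) (A (e a))).symm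
  simp only [h1, h2]
  rw [Finset.sum_comm, ← Finset.sum_neg_distrib]
  refine Finset.sum_congr rfl fun a _ ↦ ?_
  rw [← Finset.sum_neg_distrib]
  refine Finset.sum_congr rfl fun b _ ↦ ?_
  rw [hA, real_inner_comm]; ring

end Traces

namespace ThreeContactSpace

variable {V : Type*} [NormedAddCommGroup V] [InnerProductSpace ℝ V] (S : ThreeContactSpace V)

/-- The curvature 2-forms of the bundle `⟨φ_1, φ_2, φ_3⟩`. -/
def F (α δ : ℝ) (i : Fin 3) (u v : V) : ℝ := 4 * α * (δ - 2 * α) * (S.Φ i u v - S.ηη i u v)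

/-- The algebraic properties of the curvature of the canonical connection. -/
structure IsCurvature (α δ : ℝ) (R : V →ₗ[ℝ] V →ₗ[ℝ] V →ₗ[ℝ] V →ₗ[ℝ] ℝ) : Prop where
  swap : ∀ u v w z, R u v w z = - R v u w z
  skew : ∀ u v w z, R u v w z = - R u v z w
  bianchi : ∀ u v w z, R u v w z + R v w u z + R w u v z =
    inner ℝ (S.canonicalTorsion α δ u v) (S.canonicalTorsion α δ w z)
      + inner ℝ (S.canonicalTorsion α δ v w) (S.canonicalTorsion α δ u z)
      + inner ℝ (S.canonicalTorsion α δ w u) (S.canonicalTorsion α δ v z)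
  ξ_apply : ∀ i u v z, R u v (S.ξ i) z =
    S.F α δ (i + 2) u v * S.η (i + 1) z - S.F α δ (i + 1) u v * S.η (i + 2) z
  φ_apply : ∀ i u v w z, R u v (S.φ i w) z + R u v w (S.φ i z) =
    S.F α δ (i + 2) u v * inner ℝ (S.φ (i + 1) w) z
      - S.F α δ (i + 1) u v * inner ℝ (S.φ (i + 2) w) z

variable {S} {α δ : ℝ} {R : V →ₗ[ℝ] V →ₗ[ℝ] V →ₗ[ℝ] V →ₗ[ℝ] ℝ}

/-- The right side of the Bianchi identity is a 4-form, so it cancels in the usual combination of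
four Bianchi identities that proves pair symmetry in the torsion-free case. -/
theorem IsCurvature.pair_symm (hR : S.IsCurvature α δ R) (u v w z : V) :
    R u v w z = R w z u v := by
  have b1 := hR.bianchi v w u z
  have b2 := hR.bianchi w u z v
  have b3 := hR.bianchi u z v w
  have b4 := hR.bianchi z v w u
  rw [hR.skew w u z v, hR.swap z w u v, hR.skew u z w v] at b2
  rw [hR.swap v u z w, hR.skew u v z w] at b3
  rw [hR.skew v w z u, hR.skew w z v u, hR.skew z v w u] at b4
  simp only [S.canonicalTorsion_swap α δ v u, S.canonicalTorsion_swap α δ w u,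
    S.canonicalTorsion_swap α δ z u, S.canonicalTorsion_swap α δ w v,
    S.canonicalTorsion_swap α δ z v, S.canonicalTorsion_swap α δ z w,
    inner_neg_left, inner_neg_right] at b1 b2 b3 b4
  rw [real_inner_comm] at b3
  have c1 := real_inner_comm (S.canonicalTorsion α δ u v) (S.canonicalTorsion α δ w z)
  have c2 := real_inner_comm (S.canonicalTorsion α δ u w) (S.canonicalTorsion α δ v z)
  have c3 := real_inner_comm (S.canonicalTorsion α δ u z) (S.canonicalTorsion α δ v w)
  linarith

variable {ι : Type*} [Fintype ι] (e : OrthonormalBasis ι ℝ V)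

variable (S) in
-- As `ξ_i` is metrically dual to `η_i`, every frame sum with a factor `η_i(e_a)` collapses to an
-- evaluation at `ξ_i`.
theorem sum_η_mul (f : V →ₗ[ℝ] ℝ) (i : Fin 3) : ∑ a, S.η i (e a) * f (e a) = f (S.ξ i) := by
  rw [← sum_inner_mul_apply e f]
  simp only [S.inner_ξ']

variable (S) in
theorem sum_inner_φ_φ_self {n : ℕ} (hV : finrank ℝ V = 4 * n + 3) (i : Fin 3) :
    ∑ a, (inner ℝ (S.φ i (e a)) (S.φ i (e a)) : ℝ) = 4 * n + 2 := by
  have h : ∑ a, S.η i (e a) * S.η i (e a) = 1 := by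
    rw [← S.η_ξ i]; exact S.sum_η_mul e (S.η i : V →ₗ[ℝ] ℝ) i
  simp only [S.compatible, Finset.sum_sub_distrib, h, real_inner_self_eq_norm_sq, e.norm_eq_one]
  have := finrank_eq_card_basis e.toBasis
  rw [hV] at this
  simp [← this]
  ring

variable (S) in
theorem sum_inner_φ_φ_two (i : Fin 3) :
    ∑ a, (inner ℝ (S.φ i (e a)) (S.φ (i + 2) (e a)) : ℝ) = 0 := by
  have h : ∑ a, S.η (i + 2) (e a) * S.η i (e a) = 0 := by
    rw [← S.η_ξ_two i]; exact S.sum_η_mul e (S.η i : V →ₗ[ℝ] ℝ) (i + 2)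
  simp only [S.inner_φ_left, S.φ_φ_two, inner_add_right, inner_neg_right, S.inner_φ_self,
    inner_smul_right, S.inner_ξ, neg_zero, zero_add, Finset.sum_neg_distrib, h]

/-- Up to terms with `ξ`, both `φ_{i+1} φ_{i+2}` and `-φ_{i+2} φ_{i+1}` are `φ_i`. Tracing the
commutator relation for `φ_{i+1}` against `φ_{i+2}` thus gives twice the wanted sum; the trace of
`-φ_{i+2}²` contributes `4n + 2` and the two `ξ` terms contribute `2` more. -/
theorem IsCurvature.sum_apply_self_φ (hR : S.IsCurvature α δ R) {n : ℕ}
    (hV : finrank ℝ V = 4 * n + 3) (i : Fin 3) (u v : V) :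
    ∑ a, R u v (e a) (S.φ i (e a)) = (2 * n + 2) * S.F α δ i u v := by
  have h1 : ∑ a, (R u v (S.φ (i + 1) (e a)) (S.φ (i + 2) (e a))
      + R u v (e a) (S.φ (i + 1) (S.φ (i + 2) (e a)))) = (4 * n + 2) * S.F α δ i u v := by
    have : ∀ a, R u v (S.φ (i + 1) (e a)) (S.φ (i + 2) (e a))
        + R u v (e a) (S.φ (i + 1) (S.φ (i + 2) (e a)))
        = S.F α δ i u v * inner ℝ (S.φ (i + 2) (e a)) (S.φ (i + 2) (e a))
          - S.F α δ (i + 2) u v * inner ℝ (S.φ i (e a)) (S.φ (i + 2) (e a)) := by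
      intro a
      have := hR.φ_apply (i + 1) u v (e a) (S.φ (i + 2) (e a))
      rwa [fin_three_add_one_add_one, fin_three_add_one_add_two] at this
    simp only [this, Finset.sum_sub_distrib, ← Finset.mul_sum, S.sum_inner_φ_φ_self e hV,
      S.sum_inner_φ_φ_two]
    ring
  have h2 : ∑ a, R u v (S.φ (i + 1) (e a)) (S.φ (i + 2) (e a))
      = - ∑ a, R u v (e a) (S.φ (i + 2) (S.φ (i + 1) (e a))) :=
    sum_skew_apply e ((R u v).compl₂ (S.φ (i + 2) : V →ₗ[ℝ] V)) (S.φ (i + 1))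
      (S.inner_φ_left (i + 1))
  have h3 : ∑ a, S.η (i + 2) (e a) * R u v (e a) (S.ξ (i + 1)) = - S.F α δ i u v := by
    refine (S.sum_η_mul e ((R u v).flip (S.ξ (i + 1))) (i + 2)).trans ?_
    have := hR.ξ_apply (i + 2) u v (S.ξ (i + 1))
    rw [fin_three_add_two_add_one, fin_three_add_two_add_two, S.η_ξ, S.η_ξ_one] at this
    rw [LinearMap.flip_apply, this]; ring
  have h4 : ∑ a, S.η (i + 1) (e a) * R u v (e a) (S.ξ (i + 2)) = S.F α δ i u v := by
    refine (S.sum_η_mul e ((R u v).flip (S.ξ (i + 2))) (i + 1)).trans ?_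
    have := hR.ξ_apply (i + 1) u v (S.ξ (i + 2))
    rw [fin_three_add_one_add_one, fin_three_add_one_add_two, S.η_ξ, S.η_ξ_two] at this
    rw [LinearMap.flip_apply, this]; ring
  rw [Finset.sum_add_distrib, h2] at h1
  simp only [S.φ_one_φ_two, S.φ_two_φ_one, map_add, map_neg, map_smul, smul_eq_mul,
    Finset.sum_add_distrib, Finset.sum_neg_distrib, h3, h4] at h1
  linarith

end ThreeContactSpace

end ThreeSasaki

/-! ### The Ricci contraction -/

namespace ThreeSasaki

open Module

namespace ThreeContactSpace

variable {V : Type*} [NormedAddCommGroup V] [InnerProductSpace ℝ V] {S : ThreeContactSpace V}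
  {α δ : ℝ} {R : V →ₗ[ℝ] V →ₗ[ℝ] V →ₗ[ℝ] V →ₗ[ℝ] ℝ} {T : V →L[ℝ] V →L[ℝ] V}
  {ι : Type*} [Fintype ι] (e : OrthonormalBasis ι ℝ V)

variable (S) in
theorem sum_inner_canonicalTorsion_self_φ {n : ℕ} (hV : finrank ℝ V = 4 * n + 3) (i : Fin 3)
    (z : V) : ∑ a, (inner ℝ (S.canonicalTorsion α δ (e a) (S.φ i (e a))) z : ℝ)
      = (4 * δ - 16 * α - 8 * α * n) * S.η i z := by
  have hη : ∀ l m, ∑ a, S.η l (e a) * S.η m (e a) = S.η m (S.ξ l) :=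
    fun l m ↦ S.sum_η_mul e (S.η m : V →ₗ[ℝ] ℝ) l
  have hφ : ∀ l m, ∑ a, S.η l (e a) * (inner ℝ z (S.φ m (e a)) : ℝ) = inner ℝ z (S.φ m (S.ξ l)) :=
    fun l m ↦ S.sum_η_mul e ((innerSL ℝ z).comp (S.φ m) : V →ₗ[ℝ] ℝ) l
  have hφφ : ∀ l m, ∑ a, S.η l (e a) * (inner ℝ z (S.φ m (S.φ i (e a))) : ℝ)
      = inner ℝ z (S.φ m (S.φ i (S.ξ l))) :=
    fun l m ↦ S.sum_η_mul e ((innerSL ℝ z).comp ((S.φ m).comp (S.φ i)) : V →ₗ[ℝ] ℝ) l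
  have h : ∀ x, (inner ℝ (S.canonicalTorsion α δ x (S.φ i x)) z : ℝ) =
      (-2 * α * S.η i z) * inner ℝ (S.φ i x) (S.φ i x)
      + (2 * α - 2 * (δ - α)) * S.η (i + 1) z * (S.η i x * S.η (i + 1) x)
      + (2 * α - 2 * (δ - α)) * S.η (i + 2) z * (S.η i x * S.η (i + 2) x)
      + 2 * (δ - α) * S.η i z * (S.η (i + 1) x * S.η (i + 1) x)
      + 2 * (δ - α) * S.η i z * (S.η (i + 2) x * S.η (i + 2) x)
      + (-2 * α) * (S.η (i + 2) x * inner ℝ z (S.φ (i + 1) x))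
      + 2 * α * (S.η (i + 1) x * inner ℝ z (S.φ (i + 2) x))
      + (-2 * α) * (S.η i x * inner ℝ z (S.φ i (S.φ i x)))
      + (-2 * α) * (S.η (i + 1) x * inner ℝ z (S.φ (i + 1) (S.φ i x)))
      + (-2 * α) * (S.η (i + 2) x * inner ℝ z (S.φ (i + 2) (S.φ i x))) := by
    intro x
    have e0 : S.Φ i x (S.φ i x) = - inner ℝ (S.φ i x) (S.φ i x) := by
      rw [S.inner_φ_left, neg_neg, Φ]
    have e1 : S.Φ (i + 1) x (S.φ i x) = S.η i x * S.η (i + 1) x := by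
      rw [Φ, S.φ_one_φ, inner_add_right, inner_neg_right, S.inner_φ_self, inner_smul_right,
        S.inner_ξ]; ring
    have e2 : S.Φ (i + 2) x (S.φ i x) = S.η i x * S.η (i + 2) x := by
      rw [Φ, S.φ_two_φ, inner_add_right, S.inner_φ_self, inner_smul_right, S.inner_ξ]; ring
    rw [inner_canonicalTorsion, sum_fin_three_cyclic _ i, e0, e1, e2]
    simp only [ηη, S.η_φ, S.η_one_φ, S.η_two_φ, fin_three_add_one_add_one,
      fin_three_add_one_add_two, fin_three_add_two_add_one, fin_three_add_two_add_two]
    simp only [Φ]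
    ring
  simp only [h, Finset.sum_add_distrib, ← Finset.mul_sum, hη, hφ, hφφ, S.sum_inner_φ_φ_self e hV]
  simp only [S.η_ξ, S.η_one_ξ, S.η_two_ξ, S.φ_ξ, S.φ_ξ_one, S.φ_ξ_two, S.φ_one_ξ_two, S.φ_two_ξ_one, map_zero, map_neg, inner_zero_right,
    inner_neg_right, S.inner_ξ]
  ring

theorem sum_inner_torsion_torsion_φ (hT : ∀ u v, T u v = S.canonicalTorsion α δ u v) (i : Fin 3)
    (u : V) {y : V} (hy : ∀ i, S.η i y = 0) :
    ∑ a, (inner ℝ (T u (e a)) (T y (S.φ i (e a))) : ℝ) = - 4 * α ^ 2 * S.Φ i u y := by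
  have hφ : ∀ i l, S.η l (S.φ i y) = 0 := fun i l ↦ S.η_φ_hor i l hy
  have hφφ : ∀ i m l, S.η l (S.φ m (S.φ i y)) = 0 := fun i m l ↦ S.η_φ_hor m l (hφ i)
  have h : ∀ x, (inner ℝ (T u x) (T y (S.φ i x)) : ℝ) =
      2 * α * (inner ℝ (S.φ i (S.φ i y)) x * S.η i (T u x))
      + 2 * α * (inner ℝ (S.φ i (S.φ (i + 1) y)) x * S.η (i + 1) (T u x))
      + 2 * α * (inner ℝ (S.φ i (S.φ (i + 2) y)) x * S.η (i + 2) (T u x))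
      + (-2 * α) * (S.η (i + 2) x * inner ℝ (S.φ (i + 1) y) (T u x))
      + 2 * α * (S.η (i + 1) x * inner ℝ (S.φ (i + 2) y) (T u x)) := by
    intro x
    rw [real_inner_comm, hT y, inner_canonicalTorsion, sum_fin_three_cyclic _ i]
    rw [S.Φ_swap _ (T u x) y, S.Φ_swap (i + 1) (T u x) y, S.Φ_swap (i + 2) (T u x) y]
    simp only [ηη, hy, S.inner_φ_left, S.η_φ, S.η_one_φ, S.η_two_φ, Φ]
    ring
  have hI : ∀ l z, ∑ a, (inner ℝ z (e a) : ℝ) * S.η l (T u (e a)) = S.η l (T u z) :=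
    fun l z ↦ sum_inner_mul_apply e ((S.η l).comp (T u) : V →ₗ[ℝ] ℝ) z
  have hη : ∀ l z, ∑ a, S.η l (e a) * (inner ℝ z (T u (e a)) : ℝ) = inner ℝ z (T u (S.ξ l)) :=
    fun l z ↦ S.sum_η_mul e ((innerSL ℝ z).comp (T u) : V →ₗ[ℝ] ℝ) l
  have hξ : ∀ l z, (∀ i, S.η i z = 0) → (inner ℝ z (T u (S.ξ l)) : ℝ) = - (2 * α * S.Φ l u z) := by
    intro l z hz
    rw [real_inner_comm, hT, S.inner_canonicalTorsion_skew, S.inner_ξ, η_canonicalTorsion]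
    simp [ηη, hz]
  have hh : ∀ l z, (∀ i, S.η i z = 0) → S.η l (T u z) = 2 * α * S.Φ l u z := by
    intro l z hz
    rw [hT, η_canonicalTorsion]
    simp [ηη, hz]
  simp only [h, Finset.sum_add_distrib, ← Finset.mul_sum, hI, hη]
  rw [hξ _ _ (hφ _), hξ _ _ (hφ _), hh _ _ (hφφ _ _), hh _ _ (hφφ _ _), hh _ _ (hφφ _ _)]
  simp only [S.φ_φ_one, S.φ_φ_two, S.φ_sq, S.φ_one_φ_two, S.φ_two_φ_one, Φ, hy, zero_smul,
    add_zero, map_neg, inner_neg_right]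
  ring

theorem IsCurvature.sum_apply_φ_self (hR : S.IsCurvature α δ R)
    (hT : ∀ u v, T u v = S.canonicalTorsion α δ u v) {n : ℕ} (hV : finrank ℝ V = 4 * n + 3)
    (i : Fin 3) (u : V) {y : V} (hy : ∀ i, S.η i y = 0) :
    ∑ a, R (e a) u (S.φ i y) (e a) = 4 * α * (δ * (n + 2) - 3 * α) * S.Φ i u y := by
  have hφ : ∀ i l, S.η l (S.φ i y) = 0 := fun i l ↦ S.η_φ_hor i l hy
  -- Written as a component of `R`, the form `F` is visibly linear in `u`, so the contraction lemmas
  -- apply to it.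
  have hF : ∀ i u v, S.F α δ i u v = R u v (S.ξ (i + 1)) (S.ξ (i + 2)) := by
    intro i u v
    rw [hR.ξ_apply, fin_three_add_one_add_two, fin_three_add_one_add_one, S.η_ξ, S.η_ξ_two]
    ring
  have h1 : ∀ x, R x u (S.φ i y) x = - R x u y (S.φ i x)
      + inner ℝ (S.φ (i + 1) y) x * R x u (S.ξ (i + 2 + 1)) (S.ξ (i + 2 + 2))
      - inner ℝ (S.φ (i + 2) y) x * R x u (S.ξ (i + 1 + 1)) (S.ξ (i + 1 + 2)) := by
    intro x
    have := hR.φ_apply i x u y x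
    rw [hF, hF] at this
    linarith
  have h2 : ∀ z v w, ∑ a, inner ℝ z (e a) * R (e a) u v w = R z u v w :=
    fun z v w ↦ sum_inner_mul_apply e (((R.flip u).flip v).flip w) z
  -- Pair symmetry together with the skewness of `φ_i` identifies two of the three traced Bianchi
  -- terms, so the wanted sum appears in `hsum` with factor `2`.
  have hQ : ∑ a, R y (e a) u (S.φ i (e a)) = ∑ a, R (e a) u y (S.φ i (e a)) := by
    have h : ∀ x, R y x u (S.φ i x) = - R (S.φ i x) u y x := fun x ↦ by
      rw [hR.pair_symm, hR.swap]
    simp only [h, Finset.sum_neg_distrib]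
    rw [neg_eq_iff_eq_neg]
    exact sum_skew_apply e ((R.flip u).flip y) (S.φ i) (S.inner_φ_left i)
  have hb : ∀ x, R x u y (S.φ i x) + R u y x (S.φ i x) + R y x u (S.φ i x) =
      - inner ℝ (T u x) (T y (S.φ i x))
        + inner ℝ (S.canonicalTorsion α δ x (S.φ i x)) (T u y)
        + inner ℝ (T y x) (T u (S.φ i x)) := by
    intro x
    rw [hR.bianchi, S.canonicalTorsion_swap α δ x u, inner_neg_left,
      real_inner_comm (S.canonicalTorsion α δ x (S.φ i x))]
    simp only [hT]
  have h3 : ∑ a, (inner ℝ (T y (e a)) (T u (S.φ i (e a))) : ℝ)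
      = - ∑ a, inner ℝ (T u (e a)) (T y (S.φ i (e a))) := by
    have := sum_skew_apply e ((innerₗ V).compl₁₂ (T u : V →ₗ[ℝ] V) (T y : V →ₗ[ℝ] V)) (S.φ i)
      (S.inner_φ_left i)
    simp only [LinearMap.compl₁₂_apply, innerₗ_apply_apply, ContinuousLinearMap.coe_coe] at this
    rw [← this]
    exact Finset.sum_congr rfl fun a _ ↦ real_inner_comm _ _
  have hsum := Finset.sum_congr (rfl : (Finset.univ : Finset ι) = Finset.univ)
    (fun a _ ↦ hb (e a))
  simp only [Finset.sum_add_distrib, Finset.sum_neg_distrib] at hsum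
  rw [hQ, h3, hR.sum_apply_self_φ e hV, S.sum_inner_canonicalTorsion_self_φ e hV,
    sum_inner_torsion_torsion_φ e hT i u hy, hT, η_canonicalTorsion] at hsum
  simp only [h1, Finset.sum_add_distrib, Finset.sum_sub_distrib, Finset.sum_neg_distrib, h2]
  rw [← hF, ← hF]
  have f1 : S.F α δ (i + 2) (S.φ (i + 1) y) u = 4 * α * (δ - 2 * α) * S.Φ i u y := by
    rw [S.Φ_swap i u y]
    simp only [F, ηη, hφ, Φ, S.inner_φ_left (i + 1), S.φ_one_φ_two, inner_add_right,
      inner_smul_right, S.inner_ξ, hy]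
    ring
  have f2 : S.F α δ (i + 1) (S.φ (i + 2) y) u = - (4 * α * (δ - 2 * α) * S.Φ i u y) := by
    rw [S.Φ_swap i u y]
    simp only [F, ηη, hφ, Φ, S.inner_φ_left (i + 2), S.φ_two_φ_one, inner_add_right,
      inner_neg_right, inner_smul_right, S.inner_ξ, hy]
    ring
  rw [f1, f2]
  simp only [F, ηη, hy] at hsum
  linarith

theorem IsCurvature.sum_apply_ξ_self (hR : S.IsCurvature α δ R) (i : Fin 3) (u : V) :
    ∑ a, R (e a) u (S.ξ i) (e a) = 16 * α * (δ - 2 * α) * S.η i u := by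
  have hF : ∀ i u v, S.F α δ i u v = R u v (S.ξ (i + 1)) (S.ξ (i + 2)) := by
    intro i u v
    rw [hR.ξ_apply, fin_three_add_one_add_two, fin_three_add_one_add_one, S.η_ξ, S.η_ξ_two]
    ring
  have h1 : ∀ x, R x u (S.ξ i) x = S.η (i + 1) x * R x u (S.ξ (i + 2 + 1)) (S.ξ (i + 2 + 2))
      - S.η (i + 2) x * R x u (S.ξ (i + 1 + 1)) (S.ξ (i + 1 + 2)) := by
    intro x
    rw [hR.ξ_apply, hF, hF]; ring
  have h2 : ∀ l v w, ∑ a, S.η l (e a) * R (e a) u v w = R (S.ξ l) u v w :=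
    fun l v w ↦ S.sum_η_mul e (((R.flip u).flip v).flip w) l
  simp only [h1, Finset.sum_sub_distrib, h2]
  rw [← hF, ← hF]
  simp only [F]
  rw [S.Φ_swap _ (S.ξ (i + 1)) u, S.Φ_swap _ (S.ξ (i + 2)) u]
  simp only [ηη, Φ, S.φ_one_ξ_two, S.φ_two_ξ_one,
    fin_three_add_one_add_one, fin_three_add_one_add_two, fin_three_add_two_add_one,
    fin_three_add_two_add_two, S.η_ξ, S.η_ξ_one, S.η_ξ_two, S.inner_ξ, inner_neg_right]
  ring

/-- The Ricci contraction of the curvature of the canonical connection. -/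
theorem IsCurvature.ricci_eq (hR : S.IsCurvature α δ R)
    (hT : ∀ u v, T u v = S.canonicalTorsion α δ u v) {n : ℕ} (hV : finrank ℝ V = 4 * n + 3)
    (u v : V) :
    ∑ a, R (e a) u v (e a) = 4 * α * (δ * (n + 2) - 3 * α) * inner ℝ u v
      + 4 * α * (δ * (2 - n) - 5 * α) * ∑ i, S.η i u * S.η i v := by
  have h1 : ∑ a, R (e a) u (S.hor v) (e a)
      = 4 * α * (δ * (n + 2) - 3 * α) * inner ℝ u (S.hor v) := by
    -- The horizontal part of `v` is `φ_0 y` with `y = -φ_0(hor v)`, so the contraction already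
    -- computed applies.
    have hy : ∀ l, S.η l (- S.φ 0 (S.hor v)) = 0 := fun l ↦ by
      rw [map_neg, S.η_φ_hor 0 l (fun i ↦ S.η_hor i v), neg_zero]
    have hv : S.φ 0 (- S.φ 0 (S.hor v)) = S.hor v := by
      rw [map_neg, S.φ_sq, S.η_hor]; simp
    have := hR.sum_apply_φ_self e hT hV 0 u hy
    rwa [Φ, hv] at this
  have h2 : ∑ a, R (e a) u v (e a) = ∑ a, R (e a) u (S.hor v) (e a)
      + ∑ l, S.η l v * ∑ a, R (e a) u (S.ξ l) (e a) := by
    simp only [Finset.mul_sum]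
    rw [Finset.sum_comm, ← Finset.sum_add_distrib]
    refine Finset.sum_congr rfl fun a _ ↦ ?_
    conv_lhs => rw [← S.hor_add v]
    simp [LinearMap.sum_apply]
  have h3 : (inner ℝ u (S.hor v) : ℝ) = inner ℝ u v - ∑ i, S.η i u * S.η i v := by
    simp only [hor, inner_sub_right, inner_sum, inner_smul_right, S.inner_ξ, mul_comm]
  rw [h2, h1, h3]
  simp only [hR.sum_apply_ξ_self, sum_fin_three_cyclic _ 0]
  ring

end ThreeContactSpace

end ThreeSasaki

namespace ThreeSasaki

/-! ### Calculus of globally smooth vector fields -/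

section SmoothFields

variable {d : ℕ} {M : Type*} [TopologicalSpace M] [ChartedSpace (EuclideanSpace ℝ (Fin d)) M]
  [IsManifold (𝓡 d) ∞ M]

variable (d M) in
/-- Globally smooth vector fields. -/
abbrev SmoothField : Type _ :=
  ContMDiffSection (𝓡 d) (EuclideanSpace ℝ (Fin d)) ∞ (TangentSpace (𝓡 d) : M → Type _)

variable (d M) in
/-- Globally smooth real functions. -/
abbrev SmoothFun : Type _ := C^∞⟮𝓡 d, M; 𝓘(ℝ, ℝ), ℝ⟯

theorem SmoothField.diffAt (X : SmoothField d M) (x : M) : IsDiffFieldAt (fun y ↦ X y) x :=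
  X.mdifferentiableAt

omit [IsManifold (𝓡 d) ∞ M] in
theorem SmoothFun.diffAt (f : SmoothFun d M) (x : M) : MDifferentiableAt (𝓡 d) 𝓘(ℝ, ℝ) f x :=
  f.contMDiff.mdifferentiableAt (by simp)

/-- The derivative of a function along a vector field. -/
def dir (X : SmoothField d M) (f : SmoothFun d M) : SmoothFun d M :=
  ⟨fun x ↦ mvfderiv (𝓡 d) f x (X x), by
    have h1 : ContMDiff (𝓡 d).tangent 𝓘(ℝ, ℝ).tangent ∞ (tangentMap (𝓡 d) 𝓘(ℝ, ℝ) f) :=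
      f.contMDiff.contMDiff_tangentMap le_rfl
    have h2 := (contMDiff_snd_tangentBundle_modelSpace ℝ 𝓘(ℝ, ℝ) (n := ∞)).comp (h1.comp X.contMDiff)
    exact h2⟩

/-- The product of a function and a vector field. -/
def fsmul (f : SmoothFun d M) (X : SmoothField d M) : SmoothField d M :=
  ⟨fun x ↦ f x • X x, f.contMDiff.smul_section X.contMDiff⟩

omit [IsManifold (𝓡 d) ∞ M] in
theorem isManifold_minSmoothness [IsManifold (𝓡 d) ∞ M] :
    IsManifold (𝓡 d) (minSmoothness ℝ 3) M := by
  simp only [minSmoothness_of_isRCLikeNormedField]; infer_instance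

/-- The Lie bracket of vector fields. -/
def bracket (X Y : SmoothField d M) : SmoothField d M :=
  ⟨fun x ↦ VectorField.mlieBracket (𝓡 d) (fun y ↦ X y) (fun y ↦ Y y) x,
    have : IsManifold (𝓡 d) (minSmoothness ℝ 2) M := by
      simp only [minSmoothness_of_isRCLikeNormedField]; infer_instance
    have : IsManifold (𝓡 d) ((⊤ : ℕ∞) + 1) M := ‹IsManifold (𝓡 d) ∞ M›
    ContDiff.mlieBracket_vectorField (m := ⊤) (n := ⊤) X.contMDiff Y.contMDiff (by simp)⟩

@[simp] theorem fsmul_apply (f : SmoothFun d M) (X : SmoothField d M) (x : M) :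
    fsmul f X x = f x • X x := rfl

theorem dir_apply (X : SmoothField d M) (f : SmoothFun d M) (x : M) :
    dir X f x = mvfderiv (𝓡 d) f x (X x) := rfl

theorem bracket_apply (X Y : SmoothField d M) (x : M) :
    bracket X Y x = VectorField.mlieBracket (𝓡 d) (fun y ↦ X y) (fun y ↦ Y y) x := rfl

theorem dir_add (X : SmoothField d M) (f g : SmoothFun d M) : dir X (f + g) = dir X f + dir X g := by
  ext x
  have := mvfderiv_add (f.diffAt x) (g.diffAt x)
  exact congr($this (X x))

theorem dir_mul (X : SmoothField d M) (f g : SmoothFun d M) :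
    dir X (f * g) = f * dir X g + g * dir X f := by
  ext x
  have := mvfderiv_mul (f.diffAt x) (g.diffAt x)
  exact congr($this (X x))

theorem bracket_swap (X Y : SmoothField d M) : bracket X Y = - bracket Y X := by
  ext x; exact VectorField.mlieBracket_swap_apply

theorem bracket_add_right (X Y Z : SmoothField d M) :
    bracket X (Y + Z) = bracket X Y + bracket X Z := by
  ext x; exact VectorField.mlieBracket_add_right (Y.diffAt x) (Z.diffAt x)

theorem bracket_fsmul_right (X Y : SmoothField d M) (f : SmoothFun d M) :
    bracket X (fsmul f Y) = fsmul (dir X f) Y + fsmul f (bracket X Y) := by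
  ext x; exact VectorField.mlieBracket_smul_right (f.diffAt x) (Y.diffAt x)

theorem bracket_smul_right (c : ℝ) (X Y : SmoothField d M) :
    bracket X (c • Y) = c • bracket X Y := by
  ext x; exact VectorField.mlieBracket_const_smul_right (Y.diffAt x)

theorem bracket_jacobi (X Y Z : SmoothField d M) :
    bracket X (bracket Y Z) = bracket (bracket X Y) Z + bracket Y (bracket X Z) := by
  ext x
  have h : minSmoothness ℝ 2 ≤ ∞ := by
    simp only [minSmoothness_of_isRCLikeNormedField]; exact ENat.LEInfty.out
  have := isManifold_minSmoothness (d := d) (M := M)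
  exact VectorField.leibniz_identity_mlieBracket_apply ((X.contMDiff x).of_le h)
    ((Y.contMDiff x).of_le h) ((Z.contMDiff x).of_le h)

/-- Expanding the Jacobi identity for `X`, `Y`, `fZ` by the Leibniz rule leaves exactly this
identity times `Z`. Any field not vanishing at `x` serves as `Z`; later `ξ_0` does. -/
theorem dir_bracket (X Y : SmoothField d M) (f : SmoothFun d M) {x : M} (Z : SmoothField d M)
    (hZ : Z x ≠ 0) : dir (bracket X Y) f x = dir X (dir Y f) x - dir Y (dir X f) x := by
  have h := bracket_jacobi X Y (fsmul f Z)
  simp only [bracket_fsmul_right, bracket_add_right, bracket_jacobi X Y Z] at h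
  have h := congr($h x)
  simp only [ContMDiffSection.coe_add, Pi.add_apply, fsmul_apply] at h
  have h2 : (dir (bracket X Y) f x - (dir X (dir Y f) x - dir Y (dir X f) x)) • Z x = 0 := by
    refine Eq.trans ?_ (sub_eq_zero.mpr h.symm)
    module
  exact sub_eq_zero.mp ((smul_eq_zero.mp h2).resolve_right hZ)

section Extension

variable [T2Space M]

/-- A bump function cuts off the sections that are constant in a trivialization. Linearity in `v`
makes curvature expressions multilinear on the tangent space, and agreement with
`FiberBundle.extend` near `x` links them to `curvatureAt`. -/
theorem exists_linear_extension (x : M) : ∃ s : TangentSpace (𝓡 d) x →ₗ[ℝ] SmoothField d M,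
    ∀ v, (∀ᶠ y in nhds x, s v y = FiberBundle.extend (EuclideanSpace ℝ (Fin d)) v y) := by
  let t := trivializationAt (EuclideanSpace ℝ (Fin d)) (TangentSpace (𝓡 d) : M → Type _) x
  have hx : x ∈ t.baseSet := FiberBundle.mem_baseSet_trivializationAt' x
  obtain ⟨ψ, hψ, -⟩ := (SmoothBumpFunction.nhds_basis_support (I := 𝓡 d)
    (t.open_baseSet.mem_nhds hx)).mem_iff.mp (t.open_baseSet.mem_nhds hx)
  let σ : TangentSpace (𝓡 d) x → Π y : M, TangentSpace (𝓡 d) y :=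
    fun v y ↦ t.symmₗ ℝ y (t.linearMapAt ℝ x v)
  have hsm : ∀ v : TangentSpace (𝓡 d) x, ContMDiff (𝓡 d)
      ((𝓡 d).prod 𝓘(ℝ, EuclideanSpace ℝ (Fin d))) ∞ (fun y ↦ TotalSpace.mk'
        (EuclideanSpace ℝ (Fin d)) (E := (TangentSpace (𝓡 d) : M → Type _)) y
        (((ψ : M → ℝ) • σ v) y)) := by
    intro v
    refine ContMDiffOn.smul_section_of_tsupport ψ.contMDiff.contMDiffOn t.open_baseSet hψ ?_
    intro y hy
    rw [t.contMDiffWithinAt_section _ hy]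
    have h : ∀ z ∈ t.baseSet, (t ⟨z, σ v z⟩).2 = t.linearMapAt ℝ x v := by
      intro z hz
      simp only [σ]
      rw [t.symmₗ_apply hz, t.apply_mk_symm hz]
    exact ContMDiffWithinAt.congr (contMDiffWithinAt_const (c := t.linearMapAt ℝ x v)) h (h y hy)
  refine ⟨{ toFun := fun v ↦ ⟨_, hsm v⟩, map_add' := ?_, map_smul' := ?_ }, ?_⟩
  · intro u v
    ext y : 1
    change ψ y • σ (u + v) y = ψ y • σ u y + ψ y • σ v y
    simp only [σ, map_add, smul_add]
  · intro c v
    ext y : 1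
    change ψ y • σ (c • v) y = c • (ψ y • σ v y)
    simp only [σ, map_smul, smul_comm c]
  · intro v
    filter_upwards [ψ.eventuallyEq_one, t.open_baseSet.mem_nhds hx] with y hy hy'
    change ψ y • σ v y = _
    rw [hy, Pi.one_apply, one_smul]
    simp only [σ]
    rw [t.symmₗ_apply hy', t.coe_linearMapAt_of_mem hx]
    rfl

end Extension

end SmoothFields

end ThreeSasaki

/-! ### Connections, curvature and metric on smooth fields -/

namespace ThreeSasaki

section SmoothConnection

variable {d : ℕ} {M : Type*} [TopologicalSpace M] [ChartedSpace (EuclideanSpace ℝ (Fin d)) M]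
  [IsManifold (𝓡 d) ∞ M]

theorem SmoothField.diffAt_of_eventuallyEq {X : Π x : M, TangentSpace (𝓡 d) x}
    (X' : SmoothField d M) {x : M} (h : ∀ᶠ y in nhds x, X' y = X y) : IsDiffFieldAt X x :=
  (X'.diffAt x).congr_of_eventuallyEq (h.mono fun y hy ↦ by simp only [hy])

variable (D : LinearConnection d M) [hD : CovariantDerivative.ContMDiffCovariantDerivative D ∞]

/-- The covariant derivative `∇_X Y` of smooth vector fields. -/
def nab (X Y : SmoothField d M) : SmoothField d M :=
  ⟨fun x ↦ D (fun y ↦ Y y) x (X x), by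
    have h := (hD.contMDiff.contMDiff (σ := fun y ↦ Y y) Y.contMDiff.contMDiffOn)
    rw [contMDiffOn_univ] at h
    exact ContMDiff.clm_bundle_apply h X.contMDiff⟩

theorem nab_apply (X Y : SmoothField d M) (x : M) : nab D X Y x = D (fun y ↦ Y y) x (X x) := rfl

theorem nab_add (X Y Z : SmoothField d M) : nab D X (Y + Z) = nab D X Y + nab D X Z := by
  ext x
  have := D.isCovariantDerivativeOnUniv.add (Y.diffAt x) (Z.diffAt x)
  exact congr($this (X x))

theorem nab_fsmul (X Y : SmoothField d M) (f : SmoothFun d M) :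
    nab D X (fsmul f Y) = fsmul f (nab D X Y) + fsmul (dir X f) Y := by
  ext x
  have := D.isCovariantDerivativeOnUniv.leibniz (Y.diffAt x) (f.diffAt x)
  exact congr($this (X x))

theorem nab_smul (X Y : SmoothField d M) (c : ℝ) : nab D X (c • Y) = c • nab D X Y := by
  ext x
  have := D.isCovariantDerivativeOnUniv.smul_const (a := c) (Y.diffAt x)
  exact congr($this (X x))

theorem nab_neg (X Y : SmoothField d M) : nab D X (- Y) = - nab D X Y := by
  simpa using nab_smul D X Y (-1)

theorem nab_sub (X Y Z : SmoothField d M) : nab D X (Y - Z) = nab D X Y - nab D X Z := by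
  rw [sub_eq_add_neg, nab_add, nab_neg, sub_eq_add_neg]

theorem nab_add_left (X Y Z : SmoothField d M) : nab D (X + Y) Z = nab D X Z + nab D Y Z := by
  ext x; exact (D (fun y ↦ Z y) x).map_add _ _

theorem nab_smul_left (X Y : SmoothField d M) (c : ℝ) : nab D (c • X) Y = c • nab D X Y := by
  ext x; exact (D (fun y ↦ Y y) x).map_smul _ _

theorem torsion_apply_smooth (X Y : SmoothField d M) (x : M) :
    D.torsion x (X x) (Y x) = nab D X Y x - nab D Y X x - bracket X Y x :=
  D.torsion_apply (X.diffAt x) (Y.diffAt x)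

/-- The curvature on smooth vector fields. -/
def curv (X Y Z : SmoothField d M) : SmoothField d M :=
  nab D X (nab D Y Z) - nab D Y (nab D X Z) - nab D (bracket X Y) Z

theorem curv_swap (X Y Z : SmoothField d M) : curv D X Y Z = - curv D Y X Z := by
  have : nab D (bracket Y X) Z = - nab D (bracket X Y) Z := by
    rw [bracket_swap]; simpa using nab_smul_left D (bracket X Y) Z (-1)
  rw [curv, curv, this]; abel

theorem curv_add_left (X X' Y Z : SmoothField d M) :
    curv D (X + X') Y Z = curv D X Y Z + curv D X' Y Z := by
  have : bracket (X + X') Y = bracket X Y + bracket X' Y := by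
    rw [bracket_swap, bracket_add_right, bracket_swap Y X, bracket_swap Y X']; abel
  simp only [curv, this, nab_add_left, nab_add]; abel

theorem curv_smul_left (c : ℝ) (X Y Z : SmoothField d M) :
    curv D (c • X) Y Z = c • curv D X Y Z := by
  have : bracket (c • X) Y = c • bracket X Y := by
    rw [bracket_swap, bracket_smul_right, bracket_swap Y X]; module
  simp only [curv, this, nab_smul_left, nab_smul]; module

theorem curv_add_mid (X Y Y' Z : SmoothField d M) :
    curv D X (Y + Y') Z = curv D X Y Z + curv D X Y' Z := by
  rw [curv_swap, curv_add_left, curv_swap D Y, curv_swap D Y']; abel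

theorem curv_smul_mid (c : ℝ) (X Y Z : SmoothField d M) :
    curv D X (c • Y) Z = c • curv D X Y Z := by
  rw [curv_swap, curv_smul_left, curv_swap D Y]; module

theorem curv_add (X Y Z Z' : SmoothField d M) :
    curv D X Y (Z + Z') = curv D X Y Z + curv D X Y Z' := by
  simp only [curv, nab_add]; abel

theorem curv_smul (c : ℝ) (X Y Z : SmoothField d M) :
    curv D X Y (c • Z) = c • curv D X Y Z := by
  simp only [curv, nab_smul]; module

theorem curvature_eq_curv {X Y Z : Π x : M, TangentSpace (𝓡 d) x} (X' Y' Z' : SmoothField d M)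
    {x : M} (hX : ∀ᶠ y in nhds x, X' y = X y) (hY : ∀ᶠ y in nhds x, Y' y = Y y)
    (hZ : ∀ᶠ y in nhds x, Z' y = Z y) : curvature D X Y Z x = curv D X' Y' Z' x := by
  -- Agreement on a neighbourhood is needed, not just at `x`, because `D Z` is differentiated once
  -- more.
  have hDZ : ∀ᶠ y in nhds x, D (fun y ↦ Z' y) y = D Z y := by
    filter_upwards [hZ.eventually_nhds] with y hy
    exact D.isCovariantDerivativeOnUniv.congr_of_eventuallyEq (Z'.diffAt y)
      (Z'.diffAt_of_eventuallyEq hy) Filter.univ_mem hy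
  have key : ∀ {X Y : Π x : M, TangentSpace (𝓡 d) x} (X' Y' : SmoothField d M),
      (∀ᶠ y in nhds x, X' y = X y) → (∀ᶠ y in nhds x, Y' y = Y y) →
      D (fun y ↦ D Z y (Y y)) x (X x) = nab D X' (nab D Y' Z') x := by
    intro X Y X' Y' hX hY
    have h : ∀ᶠ y in nhds x, nab D Y' Z' y = D Z y (Y y) := by
      filter_upwards [hDZ, hY] with y h1 h2
      rw [nab_apply, h1, h2]
    rw [nab_apply, hX.self_of_nhds]
    congr 1
    exact (D.isCovariantDerivativeOnUniv.congr_of_eventuallyEq ((nab D Y' Z').diffAt x)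
      ((nab D Y' Z').diffAt_of_eventuallyEq h) Filter.univ_mem h).symm
  have hb : VectorField.mlieBracket (𝓡 d) X Y x = bracket X' Y' x := by
    rw [bracket_apply]
    exact (Filter.EventuallyEq.mlieBracket_vectorField_eq hX hY).symm
  rw [curvature, key X' Y' hX hY, key Y' X' hY hX, hb, ← hDZ.self_of_nhds]
  rfl

section Metric

variable [RiemannianBundle (fun x : M ↦ TangentSpace (𝓡 d) x)]
  [IsContMDiffRiemannianBundle (𝓡 d) ∞ (EuclideanSpace ℝ (Fin d))
    (fun x : M ↦ TangentSpace (𝓡 d) x)]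

/-- The inner product of vector fields. -/
def ip (X Y : SmoothField d M) : SmoothFun d M :=
  ⟨fun x ↦ inner ℝ (X x) (Y x), X.contMDiff.inner_bundle Y.contMDiff⟩

theorem ip_apply (X Y : SmoothField d M) (x : M) : ip X Y x = inner ℝ (X x) (Y x) := rfl

variable {D} in
theorem dir_ip (h : CovariantDerivative.IsMetricCompatible D) (X Y Z : SmoothField d M) :
    dir X (ip Y Z) = ip (nab D X Y) Z + ip Y (nab D X Z) := by
  ext x
  exact h.mvfderiv_inner_eq (fun y ↦ X y) (Y.diffAt x) (Z.diffAt x)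

variable {D} in
-- Apply `[X, Y] = XY - YX` to the function `g(Z, W)` and expand by metric compatibility; the mixed
-- terms cancel.
theorem ip_curv_skew (h : CovariantDerivative.IsMetricCompatible D) (X Y Z W : SmoothField d M)
    {x : M} (U : SmoothField d M) (hU : U x ≠ 0) :
    (inner ℝ (curv D X Y Z x) (W x) : ℝ) = - inner ℝ (Z x) (curv D X Y W x) := by
  have h1 := dir_bracket X Y (ip Z W) U hU
  simp only [dir_ip h, dir_add] at h1
  simp only [ContMDiffMap.coe_add, Pi.add_apply, ip_apply] at h1
  simp only [curv, ContMDiffSection.coe_sub, Pi.sub_apply, inner_sub_left, inner_sub_right]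
  linarith

end Metric

end SmoothConnection

end ThreeSasaki

/-! ### Covariant derivatives of the structure tensors, and `d(dη_i) = 0` -/

namespace ThreeSasaki

namespace AlmostThreeContactMetric

variable {n : ℕ} {M : Type*} [TopologicalSpace M]
  [ChartedSpace (EuclideanSpace ℝ (Fin (4 * n + 3))) M] [IsManifold (𝓡 (4 * n + 3)) ∞ M]
  [RiemannianBundle (fun x : M ↦ TangentSpace (𝓡 (4 * n + 3)) x)]
  (S : AlmostThreeContactMetric n M)

/-- The almost 3-contact metric structure on a tangent space. -/
def at' (x : M) : ThreeContactSpace (TangentSpace (𝓡 (4 * n + 3)) x) where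
  φ i := S.φ i x
  ξ i := S.ξ i x
  η i := S.η i x
  φ_sq i := S.φ_sq i x
  η_ξ i := S.η_ξ i x
  φ_eq i := S.φ_eq i x
  φ_eq' i := S.φ_eq' i x
  ξ_eq i := S.ξ_eq i x
  ξ_eq' i := S.ξ_eq' i x
  η_eq i := S.η_eq i x
  η_eq' i := S.η_eq' i x
  compatible i := S.compatible i x

/-- `ξ_i` as a smooth field. -/
def ξf (i : Fin 3) : SmoothField (4 * n + 3) M := ⟨S.ξ i, S.smooth_ξ i⟩

/-- `φ_i X` as a smooth field. -/
def φf (i : Fin 3) (X : SmoothField (4 * n + 3) M) : SmoothField (4 * n + 3) M :=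
  ⟨fun x ↦ S.φ i x (X x), (S.smooth_φ i).clm_bundle_apply X.contMDiff⟩

/-- `η_i(X)` as a smooth function. -/
def ηf (i : Fin 3) (X : SmoothField (4 * n + 3) M) : SmoothFun (4 * n + 3) M :=
  ⟨fun x ↦ S.η i x (X x), by
    have h : ContMDiff (𝓡 (4 * n + 3)) ((𝓡 (4 * n + 3)).prod 𝓘(ℝ, ℝ)) ∞
        (fun x ↦ TotalSpace.mk' ℝ (E := Bundle.Trivial M ℝ) x (S.η i x (X x))) :=
      (S.smooth_η i).clm_bundle_apply X.contMDiff
    intro x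
    exact (contMDiffAt_totalSpace.mp (h x)).2⟩

@[simp] theorem ξf_apply (i : Fin 3) (x : M) : S.ξf i x = (S.at' x).ξ i := rfl

@[simp] theorem φf_apply (i : Fin 3) (X : SmoothField (4 * n + 3) M) (x : M) :
    S.φf i X x = (S.at' x).φ i (X x) := rfl

@[simp] theorem ηf_apply (i : Fin 3) (X : SmoothField (4 * n + 3) M) (x : M) :
    S.ηf i X x = (S.at' x).η i (X x) := rfl

theorem ξf_ne_zero (i : Fin 3) (x : M) : S.ξf i x ≠ 0 := by
  intro h
  have := (S.at' x).η_ξ i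
  rw [← ξf_apply, h, map_zero] at this
  exact zero_ne_one this

variable [IsContMDiffRiemannianBundle (𝓡 (4 * n + 3)) ∞ (EuclideanSpace ℝ (Fin (4 * n + 3)))
  (fun x : M ↦ TangentSpace (𝓡 (4 * n + 3)) x)]
  {D : LinearConnection (4 * n + 3) M} [CovariantDerivative.ContMDiffCovariantDerivative D ∞]

/-- The condition on the covariant derivatives of the `φ_i` defining canonical connections. -/
def HasCanonicalDerivative (D : LinearConnection (4 * n + 3) M) (β : M → ℝ) : Prop :=
  ∀ (i : Fin 3) (X Y : Π x : M, TangentSpace (𝓡 (4 * n + 3)) x) (x : M),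
    IsDiffFieldAt X x → IsDiffFieldAt Y x →
    covEndo D (S.φ i) X Y x =
      β x • (S.η (i + 2) x (X x) • S.φ (i + 1) x (Y x)
        - S.η (i + 1) x (X x) • S.φ (i + 2) x (Y x))

variable {S} {β : M → ℝ}

omit [IsContMDiffRiemannianBundle (𝓡 (4 * n + 3)) ∞ (EuclideanSpace ℝ (Fin (4 * n + 3)))
  (fun x : M ↦ TangentSpace (𝓡 (4 * n + 3)) x)] in
theorem HasCanonicalDerivative.nab_φf (hβ : S.HasCanonicalDerivative D β) (i : Fin 3)
    (X Y : SmoothField (4 * n + 3) M) (x : M) :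
    nab D X (S.φf i Y) x = (S.at' x).φ i (nab D X Y x)
      + β x • ((S.at' x).η (i + 2) (X x) • (S.at' x).φ (i + 1) (Y x)
        - (S.at' x).η (i + 1) (X x) • (S.at' x).φ (i + 2) (Y x)) := by
  have h := hβ i (fun y ↦ X y) (fun y ↦ Y y) x (X.diffAt x) (Y.diffAt x)
  exact sub_eq_iff_eq_add'.mp h

theorem ip_ξf_self (i : Fin 3) (X : SmoothField (4 * n + 3) M) : ip X (S.ξf i) = S.ηf i X := by
  ext x; exact (S.at' x).inner_ξ i (X x)

theorem η_nab_ξf (hm : D.IsMetricCompatible) (i : Fin 3) (X : SmoothField (4 * n + 3) M) (x : M) :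
    (S.at' x).η i (nab D X (S.ξf i) x) = 0 := by
  have h1 := congr($(dir_ip hm X (S.ξf i) (S.ξf i)) x)
  have h2 : dir X (ip (S.ξf i) (S.ξf i)) x = 0 := by
    have : ip (S.ξf i) (S.ξf i) = 1 := by
      ext y; rw [ip_ξf_self]; exact S.η_ξ i y
    rw [this, dir_apply]
    have h : mvfderiv (𝓡 (4 * n + 3)) (fun _ : M ↦ (1 : ℝ)) x = 0 := mvfderiv_const 1
    exact congr($h (X x))
  rw [h2] at h1
  simp only [ContMDiffMap.coe_add, Pi.add_apply, ip_apply, ξf_apply,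
    (S.at' x).inner_ξ, (S.at' x).inner_ξ'] at h1
  linarith

/-- Differentiate `φ_i ξ_i = 0` and apply `φ_i`. This recovers `∇_X ξ_i` up to its `ξ_i` component,
which vanishes because `ξ_i` has unit length. -/
theorem HasCanonicalDerivative.nab_ξf (hβ : S.HasCanonicalDerivative D β)
    (hm : D.IsMetricCompatible) (i : Fin 3) (X : SmoothField (4 * n + 3) M) (x : M) :
    nab D X (S.ξf i) x = β x • ((S.at' x).η (i + 2) (X x) • (S.at' x).ξ (i + 1)
        - (S.at' x).η (i + 1) (X x) • (S.at' x).ξ (i + 2)) := by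
  have h := hβ.nab_φf i X (S.ξf i) x
  have h0 : S.φf i (S.ξf i) = 0 := by ext y : 1; exact (S.at' y).φ_ξ i
  have h1 : nab D X (0 : SmoothField (4 * n + 3) M) = 0 := by
    simpa using nab_smul D X 0 0
  rw [h0, h1] at h
  have h2 := congrArg ((S.at' x).φ i) h
  simp only [ContMDiffSection.coe_zero, Pi.zero_apply, map_zero, map_add, map_smul, map_sub,
    (S.at' x).φ_sq, η_nab_ξf hm, ξf_apply, (S.at' x).φ_one_ξ, (S.at' x).φ_two_ξ,
    (S.at' x).φ_ξ_one, (S.at' x).φ_ξ_two, map_neg, neg_neg] at h2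
  rw [zero_smul, add_zero] at h2
  exact (neg_add_eq_zero.mp h2.symm).trans (by module)

theorem HasCanonicalDerivative.dir_ηf (hβ : S.HasCanonicalDerivative D β)
    (hm : D.IsMetricCompatible) (i : Fin 3) (X Y : SmoothField (4 * n + 3) M) (x : M) :
    dir X (S.ηf i Y) x = (S.at' x).η i (nab D X Y x)
      + β x * ((S.at' x).η (i + 2) (X x) * (S.at' x).η (i + 1) (Y x)
        - (S.at' x).η (i + 1) (X x) * (S.at' x).η (i + 2) (Y x)) := by
  rw [← ip_ξf_self, dir_ip hm]
  simp only [ContMDiffMap.coe_add, Pi.add_apply, ip_apply, ξf_apply, hβ.nab_ξf hm,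
    inner_smul_right, inner_sub_right, (S.at' x).inner_ξ]

end AlmostThreeContactMetric

end ThreeSasaki

namespace ThreeSasaki

section

theorem finrank_tangentSpace {d : ℕ} {M : Type*} [TopologicalSpace M]
    [ChartedSpace (EuclideanSpace ℝ (Fin d)) M] (x : M) :
    Module.finrank ℝ (TangentSpace (𝓡 d) x) = d :=
  (finrank_euclideanSpace_fin : Module.finrank ℝ (EuclideanSpace ℝ (Fin d)) = d)

variable {d : ℕ} {M : Type*} [TopologicalSpace M] [ChartedSpace (EuclideanSpace ℝ (Fin d)) M]
  [IsManifold (𝓡 d) ∞ M]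

theorem dir_smul (c : ℝ) (X : SmoothField d M) (f : SmoothFun d M) :
    dir X (c • f) = c • dir X f := by
  ext x
  have h := const_smul_mfderiv (f.diffAt x) c
  exact congr($h (X x))

theorem dir_sub (X : SmoothField d M) (f g : SmoothFun d M) :
    dir X (f - g) = dir X f - dir X g := by
  have h := dir_smul (-1) X g
  rw [neg_one_smul, neg_one_smul] at h
  rw [sub_eq_add_neg, dir_add, h, sub_eq_add_neg]

end

namespace AlmostThreeContactMetric

variable {n : ℕ} {M : Type*} [TopologicalSpace M]
  [ChartedSpace (EuclideanSpace ℝ (Fin (4 * n + 3))) M] [IsManifold (𝓡 (4 * n + 3)) ∞ M]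
  [RiemannianBundle (fun x : M ↦ TangentSpace (𝓡 (4 * n + 3)) x)]
  [IsContMDiffRiemannianBundle (𝓡 (4 * n + 3)) ∞ (EuclideanSpace ℝ (Fin (4 * n + 3)))
    (fun x : M ↦ TangentSpace (𝓡 (4 * n + 3)) x)]
  (S : AlmostThreeContactMetric n M)

/-- The values of the 2-form `a Φ_l + b η_j ∧ η_k` on smooth fields. -/
def form (a b : ℝ) (l : Fin 3) (Y Z : SmoothField (4 * n + 3) M) : SmoothFun (4 * n + 3) M :=
  a • ip Y (S.φf l Z) + b • (S.ηf (l + 1) Y * S.ηf (l + 2) Z - S.ηf (l + 2) Y * S.ηf (l + 1) Z)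

@[simp] theorem form_apply (a b : ℝ) (l : Fin 3) (Y Z : SmoothField (4 * n + 3) M) (x : M) :
    S.form a b l Y Z x = a * (S.at' x).Φ l (Y x) (Z x) + b * (S.at' x).ηη l (Y x) (Z x) := rfl

variable {S} {D : LinearConnection (4 * n + 3) M}
  [CovariantDerivative.ContMDiffCovariantDerivative D ∞] {β : M → ℝ}

/-- The forms `Φ_l` and `η_j ∧ η_k` rotate in the same way as the `φ_l`. The coefficients stay free
because the lemma serves both `dη_l` and the torsion, where the second coefficient has opposite
sign. -/
theorem HasCanonicalDerivative.dir_form (hβ : S.HasCanonicalDerivative D β)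
    (hm : D.IsMetricCompatible) (a b : ℝ) (l : Fin 3) (X Y Z : SmoothField (4 * n + 3) M) (x : M) :
    dir X (S.form a b l Y Z) x = S.form a b l (nab D X Y) Z x + S.form a b l Y (nab D X Z) x
      + β x * ((S.at' x).η (l + 2) (X x) * S.form a b (l + 1) Y Z x
        - (S.at' x).η (l + 1) (X x) * S.form a b (l + 2) Y Z x) := by
  have h : dir X (S.form a b l Y Z) = a • dir X (ip Y (S.φf l Z))
      + b • (dir X (S.ηf (l + 1) Y * S.ηf (l + 2) Z) - dir X (S.ηf (l + 2) Y * S.ηf (l + 1) Z)) := by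
    rw [form, dir_add, dir_smul, dir_smul, dir_sub]
  rw [h, dir_ip hm, dir_mul, dir_mul]
  simp only [ContMDiffMap.coe_add, ContMDiffMap.coe_mul, ContMDiffMap.coe_smul, ContMDiffMap.coe_sub,
    Pi.add_apply, Pi.sub_apply, Pi.mul_apply, Pi.smul_apply, smul_eq_mul, ip_apply, form_apply,
    ηf_apply, φf_apply, hβ.nab_φf, hβ.dir_ηf hm, ThreeContactSpace.Φ, ThreeContactSpace.ηη,
    inner_add_right, inner_sub_right, inner_smul_right, fin_three_add_one_add_one,
    fin_three_add_one_add_two, fin_three_add_two_add_one, fin_three_add_two_add_two]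
  ring

variable {α δ : ℝ}

omit [CovariantDerivative.ContMDiffCovariantDerivative D ∞] in
theorem IsThreeSasaki.form_eq (hS : S.IsThreeSasaki α δ) (i : Fin 3)
    (X Y : SmoothField (4 * n + 3) M) :
    S.form (2 * α) (2 * (α - δ)) i X Y =
      dir X (S.ηf i Y) - dir Y (S.ηf i X) - S.ηf i (bracket X Y) := by
  ext x
  exact (hS.extDeriv_η i (fun y ↦ X y) (fun y ↦ Y y) x (X.diffAt x) (Y.diffAt x)).symm

theorem IsThreeSasaki.η_torsion (hS : S.IsThreeSasaki α δ) (hβ : S.HasCanonicalDerivative D β)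
    (hm : D.IsMetricCompatible) (i : Fin 3) (X Y : SmoothField (4 * n + 3) M) (x : M) :
    (S.at' x).η i (D.torsion x (X x) (Y x)) =
      (S.at' x).dη α δ i (X x) (Y x) + 2 * β x * (S.at' x).ηη i (X x) (Y x) := by
  have h := congr($(hS.form_eq i X Y) x)
  simp only [ContMDiffMap.coe_sub, Pi.sub_apply, hβ.dir_ηf hm, form_apply, ηf_apply] at h
  rw [torsion_apply_smooth, map_sub, map_sub, ThreeContactSpace.dη, h, ThreeContactSpace.ηη]
  ring

/-- This is `d(dη_i) = 0` expressed by a connection with torsion: `dω(X,Y,Z)` is the cyclic sum of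
`(∇_X ω)(Y,Z) + ω(T(X,Y),Z)`. -/
theorem IsThreeSasaki.closed_torsion (hS : S.IsThreeSasaki α δ) (hβ : S.HasCanonicalDerivative D β)
    (hm : D.IsMetricCompatible) (i : Fin 3) (X Y Z : SmoothField (4 * n + 3) M) (x : M) :
    let P := S.at' x
    let T := D.torsion x
    (β x * (P.η (i + 2) (X x) * P.dη α δ (i + 1) (Y x) (Z x)
          - P.η (i + 1) (X x) * P.dη α δ (i + 2) (Y x) (Z x)) + P.dη α δ i (T (X x) (Y x)) (Z x))
      + (β x * (P.η (i + 2) (Y x) * P.dη α δ (i + 1) (Z x) (X x)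
          - P.η (i + 1) (Y x) * P.dη α δ (i + 2) (Z x) (X x)) + P.dη α δ i (T (Y x) (Z x)) (X x))
      + (β x * (P.η (i + 2) (Z x) * P.dη α δ (i + 1) (X x) (Y x)
          - P.η (i + 1) (Z x) * P.dη α δ (i + 2) (X x) (Y x)) + P.dη α δ i (T (Z x) (X x)) (Y x))
      = 0 := by
  intro P T
  let W := S.form (2 * α) (2 * (α - δ)) i
  have hW : ∀ X Y, W X Y = dir X (S.ηf i Y) - dir Y (S.ηf i X) - S.ηf i (bracket X Y) := hS.form_eq i
  -- The bracket form of `d(dη_i) = 0`: second derivatives cancel by `dir_bracket`, iterated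
  -- brackets by Jacobi.
  have h0 : dir X (W Y Z) x + dir Y (W Z X) x + dir Z (W X Y) x
      - (W (bracket X Y) Z x + W (bracket Y Z) X x + W (bracket Z X) Y x) = 0 := by
    simp only [hW, dir_sub, ContMDiffMap.coe_sub, Pi.sub_apply,
      dir_bracket _ _ _ (S.ξf 0) (S.ξf_ne_zero 0 x)]
    have hj := congr((S.at' x).η i ($(bracket_jacobi X Y Z) x))
    rw [bracket_swap X (bracket Y Z), bracket_swap Y (bracket X Z), bracket_swap X Z] at hj
    have hn : bracket (-bracket Z X) Y = - bracket (bracket Z X) Y := by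
      rw [bracket_swap, bracket_swap (bracket Z X), neg_inj]
      simpa using bracket_smul_right (-1) Y (bracket Z X)
    rw [hn] at hj
    simp only [ContMDiffSection.coe_add, ContMDiffSection.coe_neg, Pi.add_apply, Pi.neg_apply,
      map_add, map_neg] at hj
    simp only [ηf_apply]
    linarith
  have hb : ∀ X Y Z, W (bracket X Y) Z x = P.dη α δ i (nab D X Y x) (Z x)
      - P.dη α δ i (nab D Y X x) (Z x) - P.dη α δ i (T (X x) (Y x)) (Z x) := by
    intro X Y Z
    have h : bracket X Y x = nab D X Y x - nab D Y X x - T (X x) (Y x) := by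
      simp only [T]; rw [torsion_apply_smooth]; abel
    simp only [W, form_apply, h, ThreeContactSpace.dη, ThreeContactSpace.Φ, ThreeContactSpace.ηη,
      map_sub, inner_sub_left, P]
    ring
  have hd : ∀ X Y Z, dir X (W Y Z) x = P.dη α δ i (nab D X Y x) (Z x)
      + P.dη α δ i (Y x) (nab D X Z x)
      + β x * (P.η (i + 2) (X x) * P.dη α δ (i + 1) (Y x) (Z x)
          - P.η (i + 1) (X x) * P.dη α δ (i + 2) (Y x) (Z x)) := fun X Y Z ↦
    hβ.dir_form hm _ _ i X Y Z x
  have hs : ∀ u v, P.dη α δ i u v = - P.dη α δ i v u := fun u v ↦ by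
    rw [ThreeContactSpace.dη, ThreeContactSpace.dη, P.Φ_swap, P.ηη_swap]; ring
  rw [hb, hb, hb, hd, hd, hd, hs (Y x) (nab D X Z x), hs (Z x) (nab D Y X x),
    hs (X x) (nab D Z Y x)] at h0
  linarith

variable [T2Space M]

theorem IsThreeSasaki.isTorsion (hS : S.IsThreeSasaki α δ) (hβ : S.HasCanonicalDerivative D β)
    (hD : IsMetricWithSkewTorsion D) (x : M) : (S.at' x).IsTorsion α δ (β x) (D.torsion x) := by
  obtain ⟨s, hs⟩ := exists_linear_extension (d := 4 * n + 3) x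
  have hsx : ∀ v, s v x = v := fun v ↦ by
    rw [(hs v).self_of_nhds, FiberBundle.extend_apply_self]
  refine ⟨fun u v ↦ ?_, hD.skew x, fun i u v ↦ ?_, fun i u v w ↦ ?_⟩
  · have h1 := torsion_apply_smooth D (s u) (s v) x
    have h2 := torsion_apply_smooth D (s v) (s u) x
    rw [hsx, hsx] at h1 h2
    rw [h1, h2, bracket_swap (s u)]
    simp only [ContMDiffSection.coe_neg, Pi.neg_apply]
    abel
  · simpa only [hsx] using hS.η_torsion hβ hD.metric i (s u) (s v) x
  · simpa only [hsx] using hS.closed_torsion hβ hD.metric i (s u) (s v) (s w) x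

theorem IsThreeSasaki.beta_eq (hn : 1 ≤ n) (hS : S.IsThreeSasaki α δ)
    (hβ : S.HasCanonicalDerivative D β) (hD : IsMetricWithSkewTorsion D) :
    β = fun _ ↦ 2 * δ - 4 * α := by
  ext x
  exact (hS.isTorsion hβ hD x).eq_beta hS.α_ne_zero (by rw [finrank_tangentSpace]; omega)

theorem IsThreeSasaki.torsion_eq (hn : 1 ≤ n) (hS : S.IsThreeSasaki α δ)
    (hβ : S.HasCanonicalDerivative D β) (hD : IsMetricWithSkewTorsion D) (x : M)
    (u v : TangentSpace (𝓡 (4 * n + 3)) x) :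
    D.torsion x u v = (S.at' x).canonicalTorsion α δ u v :=
  (hS.isTorsion hβ hD x).eq_canonicalTorsion hS.α_ne_zero (by rw [finrank_tangentSpace]; omega) u v

end AlmostThreeContactMetric
end ThreeSasaki

/-! ### Parallel torsion, the Bianchi identity and the curvature acting on `φ_i` -/

namespace ThreeSasaki

section

variable {d : ℕ} {M : Type*} [TopologicalSpace M] [ChartedSpace (EuclideanSpace ℝ (Fin d)) M]
  [IsManifold (𝓡 d) ∞ M] (D : LinearConnection d M)
  [CovariantDerivative.ContMDiffCovariantDerivative D ∞]

/-- The torsion on smooth vector fields. -/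
def tors (X Y : SmoothField d M) : SmoothField d M := nab D X Y - nab D Y X - bracket X Y

theorem tors_apply (X Y : SmoothField d M) (x : M) : tors D X Y x = D.torsion x (X x) (Y x) :=
  (torsion_apply_smooth D X Y x).symm

theorem sum_curv_eq (X Y Z : SmoothField d M) :
    curv D X Y Z + curv D Y Z X + curv D Z X Y =
      (nab D X (tors D Y Z) + tors D X (bracket Y Z))
      + (nab D Y (tors D Z X) + tors D Y (bracket Z X))
      + (nab D Z (tors D X Y) + tors D Z (bracket X Y)) := by
  have hj := bracket_jacobi X Y Z
  rw [bracket_swap (bracket X Y) Z, bracket_swap X Z] at hj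
  have hn : bracket Y (-bracket Z X) = - bracket Y (bracket Z X) := by
    simpa using bracket_smul_right (-1) Y (bracket Z X)
  rw [hn] at hj
  have hj' : bracket X (bracket Y Z) + bracket Y (bracket Z X) + bracket Z (bracket X Y) = 0 := by
    rw [hj]; abel
  simp only [curv, tors, nab_sub]
  rw [← sub_eq_zero, ← hj']
  abel

/-- The first Bianchi identity of a connection with parallel torsion. -/
theorem sum_curv_apply (X Y Z : SmoothField d M) (x : M)
    (hT : ∀ X Y Z : SmoothField d M, nab D X (tors D Y Z) x =
      D.torsion x (nab D X Y x) (Z x) + D.torsion x (Y x) (nab D X Z x)) :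
    curv D X Y Z x + curv D Y Z X x + curv D Z X Y x =
      D.torsion x (D.torsion x (X x) (Y x)) (Z x) + D.torsion x (D.torsion x (Y x) (Z x)) (X x)
        + D.torsion x (D.torsion x (Z x) (X x)) (Y x) := by
  have hb : ∀ Y Z : SmoothField d M, bracket Y Z x =
      nab D Y Z x - nab D Z Y x - D.torsion x (Y x) (Z x) := fun Y Z ↦ by
    rw [torsion_apply_smooth]; abel
  have hs : ∀ u v : TangentSpace (𝓡 d) x, D.torsion x u v = - D.torsion x v u := fun u v ↦
    D.torsion_antisymm u v
  have h := congr($(sum_curv_eq D X Y Z) x)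
  simp only [ContMDiffSection.coe_add, Pi.add_apply, hT, tors_apply, hb, map_sub] at h
  rw [h, hs _ (X x), hs _ (Y x), hs _ (Z x), hs (X x) (nab D Z Y x), hs (Y x) (nab D X Z x),
    hs (Z x) (nab D Y X x), hs (D.torsion x (X x) (Y x)), hs (D.torsion x (Y x) (Z x)),
    hs (D.torsion x (Z x) (X x))]
  abel

end

namespace AlmostThreeContactMetric

variable {n : ℕ} {M : Type*} [TopologicalSpace M]
  [ChartedSpace (EuclideanSpace ℝ (Fin (4 * n + 3))) M] [IsManifold (𝓡 (4 * n + 3)) ∞ M]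
  [RiemannianBundle (fun x : M ↦ TangentSpace (𝓡 (4 * n + 3)) x)]
  [IsContMDiffRiemannianBundle (𝓡 (4 * n + 3)) ∞ (EuclideanSpace ℝ (Fin (4 * n + 3)))
    (fun x : M ↦ TangentSpace (𝓡 (4 * n + 3)) x)]
  {S : AlmostThreeContactMetric n M} {D : LinearConnection (4 * n + 3) M}
  [CovariantDerivative.ContMDiffCovariantDerivative D ∞] {β : M → ℝ} {α δ : ℝ}

/-- The canonical torsion is parallel for every connection satisfying the derivative condition. -/
theorem HasCanonicalDerivative.nab_tors (hβ : S.HasCanonicalDerivative D β)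
    (hm : D.IsMetricCompatible)
    (hT : ∀ x u v, D.torsion x u v = (S.at' x).canonicalTorsion α δ u v)
    (X Y Z : SmoothField (4 * n + 3) M) (x : M) :
    nab D X (tors D Y Z) x =
      D.torsion x (nab D X Y x) (Z x) + D.torsion x (Y x) (nab D X Z x) := by
  let t : Fin 3 → SmoothField (4 * n + 3) M := fun l ↦
    fsmul (S.form (2 * α) (2 * (δ - α)) l Y Z) (S.ξf l)
      + (2 * α) • (fsmul (S.ηf l Z) (S.φf l Y) - fsmul (S.ηf l Y) (S.φf l Z))
  have ht : tors D Y Z = t 0 + t (0 + 1) + t (0 + 2) := by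
    ext y : 1
    rw [tors_apply, hT, ThreeContactSpace.canonicalTorsion, sum_fin_three_cyclic _ 0]
    rfl
  rw [ht, hT, hT]
  -- The `β` terms form an infinitesimal rotation of the index `l`, under which the sum defining the
  -- torsion is invariant. They cancel for every `β`.
  simp only [t, nab_add, nab_smul, nab_sub, nab_fsmul, ContMDiffSection.coe_add, Pi.add_apply,
    ContMDiffSection.coe_smul, Pi.smul_apply, ContMDiffSection.coe_sub, Pi.sub_apply, fsmul_apply,
    hβ.dir_form hm, hβ.dir_ηf hm, hβ.nab_φf, hβ.nab_ξf hm, form_apply, ηf_apply, φf_apply, ξf_apply,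
    ThreeContactSpace.canonicalTorsion, sum_fin_three_cyclic _ 0,
    fin_three_add_one_add_one, fin_three_add_one_add_two, fin_three_add_two_add_one,
    fin_three_add_two_add_two]
  module

/-- The rotation has constant `β`, so its curvature is `β (dη_i + β η_j ∧ η_k)`. At `β = 2δ - 4α`
this is `F_i`. -/
theorem IsThreeSasaki.curv_φf (hS : S.IsThreeSasaki α δ)
    (hβ : S.HasCanonicalDerivative D fun _ ↦ 2 * δ - 4 * α) (i : Fin 3)
    (X Y Z : SmoothField (4 * n + 3) M) (x : M) :
    curv D X Y (S.φf i Z) x = (S.at' x).φ i (curv D X Y Z x)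
      + ((S.at' x).F α δ (i + 2) (X x) (Y x) • (S.at' x).φ (i + 1) (Z x)
        - (S.at' x).F α δ (i + 1) (X x) (Y x) • (S.at' x).φ (i + 2) (Z x)) := by
  have h : ∀ i X Z, nab D X (S.φf i Z) = S.φf i (nab D X Z)
      + (2 * δ - 4 * α) • (fsmul (S.ηf (i + 2) X) (S.φf (i + 1) Z)
        - fsmul (S.ηf (i + 1) X) (S.φf (i + 2) Z)) := fun i X Z ↦ by
    ext y : 1; exact hβ.nab_φf i X Z y
  have hη : ∀ i, (S.at' x).η i (bracket X Y x) = dir X (S.ηf i Y) x - dir Y (S.ηf i X) x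
      - (2 * α * (S.at' x).Φ i (X x) (Y x) + 2 * (α - δ) * (S.at' x).ηη i (X x) (Y x)) :=
    fun i ↦ by
      have := congr($(hS.form_eq i X Y) x)
      simp only [ContMDiffMap.coe_sub, Pi.sub_apply, form_apply, ηf_apply] at this
      linarith
  simp only [curv, h, nab_add, nab_smul, nab_sub, nab_fsmul, ContMDiffSection.coe_add, Pi.add_apply,
    ContMDiffSection.coe_smul, Pi.smul_apply, ContMDiffSection.coe_sub, Pi.sub_apply, fsmul_apply,
    ηf_apply, φf_apply, hη, map_sub,
    ThreeContactSpace.F, ThreeContactSpace.ηη,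
    fin_three_add_one_add_one, fin_three_add_one_add_two, fin_three_add_two_add_one,
    fin_three_add_two_add_two]
  module

end AlmostThreeContactMetric
end ThreeSasaki

/-! ### The curvature as a multilinear form on a tangent space -/

namespace ThreeSasaki

/-- The quadrilinear form `g(R(u, v)w, z)` at `x`, computed with a linear family `s` of fields
extending the tangent vectors at `x`. -/
def curvForm {d : ℕ} {M : Type*} [TopologicalSpace M] [ChartedSpace (EuclideanSpace ℝ (Fin d)) M]
    [IsManifold (𝓡 d) ∞ M] [RiemannianBundle (fun x : M ↦ TangentSpace (𝓡 d) x)]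
    (D : LinearConnection d M) [CovariantDerivative.ContMDiffCovariantDerivative D ∞] {x : M}
    (s : TangentSpace (𝓡 d) x →ₗ[ℝ] SmoothField d M) :
    TangentSpace (𝓡 d) x →ₗ[ℝ] TangentSpace (𝓡 d) x →ₗ[ℝ] TangentSpace (𝓡 d) x →ₗ[ℝ]
      TangentSpace (𝓡 d) x →ₗ[ℝ] ℝ :=
  LinearMap.mk₂ ℝ (fun u v ↦ LinearMap.mk₂ ℝ (fun w z ↦ inner ℝ (curv D (s u) (s v) (s w) x) z)
      (fun w w' z ↦ by
        rw [map_add, curv_add]; exact inner_add_left _ _ _)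
      (fun c w z ↦ by
        rw [map_smul, curv_smul]; exact real_inner_smul_left _ _ _)
      (fun w z z' ↦ inner_add_right _ _ _)
      (fun c w z ↦ real_inner_smul_right _ _ _))
    (fun u u' v ↦ by
      ext w z
      simp only [LinearMap.mk₂_apply, map_add, curv_add_left, LinearMap.add_apply]
      exact inner_add_left _ _ _)
    (fun c u v ↦ by
      ext w z
      simp only [LinearMap.mk₂_apply, map_smul, curv_smul_left, LinearMap.smul_apply]
      exact real_inner_smul_left _ _ _)
    (fun u v v' ↦ by
      ext w z
      simp only [LinearMap.mk₂_apply, map_add, curv_add_mid, LinearMap.add_apply]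
      exact inner_add_left _ _ _)
    (fun c u v ↦ by
      ext w z
      simp only [LinearMap.mk₂_apply, map_smul, curv_smul_mid, LinearMap.smul_apply]
      exact real_inner_smul_left _ _ _)

namespace ThreeContactSpace

variable {V : Type*} [NormedAddCommGroup V] [InnerProductSpace ℝ V] (S : ThreeContactSpace V)

theorem inner_add_three_left {a b c a' b' c' : V} (h : a + b + c = a' + b' + c') (z : V) :
    (inner ℝ a z + inner ℝ b z + inner ℝ c z : ℝ) = inner ℝ a' z + inner ℝ b' z + inner ℝ c' z := by
  simp only [← inner_add_left, h]

theorem inner_hor (u v : V) :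
    (inner ℝ (S.hor u) (S.hor v) : ℝ) = inner ℝ u v - ∑ i, S.η i u * S.η i v := by
  have h : (inner ℝ (S.hor u) (S.hor v) : ℝ) = inner ℝ u (S.hor v) := by
    conv_lhs => arg 2; rw [hor]
    simp [inner_sub_left, sum_inner, inner_smul_left, S.inner_ξ', S.η_hor]
  rw [h]
  simp only [hor, inner_sub_right, inner_sum, inner_smul_right, S.inner_ξ, mul_comm]

theorem inner_vert (u v : V) :
    (inner ℝ (∑ i, S.η i u • S.ξ i) (∑ i, S.η i v • S.ξ i) : ℝ) = ∑ i, S.η i u * S.η i v := by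
  have h : ∀ i, S.η i (∑ l, S.η l v • S.ξ l) = S.η i v := fun i ↦ by
    have := congrArg (S.η i) (S.hor_add v)
    rwa [map_add, S.η_hor, zero_add] at this
  simp only [sum_inner, inner_smul_left, S.inner_ξ', h, RCLike.conj_to_real]

/-- Put `w = ξ_i` and `φ_i z` for `z`: then `φ_i ξ_i = 0`, and `φ_i² z` is `-z` up to a multiple of
`ξ_i`, on which skewness kills `R(u,v,ξ_i,·)`. -/
theorem ξ_apply_of_φ_apply {α δ : ℝ} {R : V →ₗ[ℝ] V →ₗ[ℝ] V →ₗ[ℝ] V →ₗ[ℝ] ℝ}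
    (hskew : ∀ u v w z, R u v w z = - R u v z w)
    (hφ : ∀ i u v w z, R u v (S.φ i w) z + R u v w (S.φ i z) =
      S.F α δ (i + 2) u v * inner ℝ (S.φ (i + 1) w) z
        - S.F α δ (i + 1) u v * inner ℝ (S.φ (i + 2) w) z) (i : Fin 3) (u v z : V) :
    R u v (S.ξ i) z =
      S.F α δ (i + 2) u v * S.η (i + 1) z - S.F α δ (i + 1) u v * S.η (i + 2) z := by
  have h := hφ i u v (S.ξ i) (S.φ i z)
  have h0 := hskew u v (S.ξ i) (S.ξ i)
  rw [S.φ_ξ, S.φ_sq, S.φ_one_ξ, S.φ_two_ξ, inner_neg_left, S.inner_ξ', S.inner_ξ', S.η_two_φ,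
    S.η_one_φ, map_zero, LinearMap.zero_apply, map_add, map_neg, map_smul, smul_eq_mul] at h
  have h0' : R u v (S.ξ i) (S.ξ i) = 0 := by linarith
  rw [h0'] at h
  linarith

theorem sum_η_self {ι : Type*} [Fintype ι] (e : OrthonormalBasis ι ℝ V) :
    ∑ a, ∑ i, S.η i (e a) * S.η i (e a) = 3 := by
  rw [Finset.sum_comm]
  have h : ∀ i, ∑ a, S.η i (e a) * S.η i (e a) = 1 := fun i ↦ by
    have := sum_inner_mul_apply e (S.η i : V →ₗ[ℝ] ℝ) (S.ξ i)
    simpa [S.inner_ξ', S.η_ξ] using this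
  simp [h]

end ThreeContactSpace

namespace AlmostThreeContactMetric

variable {n : ℕ} {M : Type*} [TopologicalSpace M] [T2Space M]
  [ChartedSpace (EuclideanSpace ℝ (Fin (4 * n + 3))) M] [IsManifold (𝓡 (4 * n + 3)) ∞ M]
  [RiemannianBundle (fun x : M ↦ TangentSpace (𝓡 (4 * n + 3)) x)]
  [IsContMDiffRiemannianBundle (𝓡 (4 * n + 3)) ∞ (EuclideanSpace ℝ (Fin (4 * n + 3)))
    (fun x : M ↦ TangentSpace (𝓡 (4 * n + 3)) x)]
  {S : AlmostThreeContactMetric n M} {D : LinearConnection (4 * n + 3) M}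
  [CovariantDerivative.ContMDiffCovariantDerivative D ∞] {β : M → ℝ} {α δ : ℝ}

/-- Skewness gives tensoriality in `Z`: in `g(R(X,Y)Z, W) = -g(Z, R(X,Y)W)` the right side involves
only the value of `Z` at `x`. The structure `S` supplies the nonvanishing field `ξ_0`. -/
theorem curv_congr (S : AlmostThreeContactMetric n M) (hm : D.IsMetricCompatible) (X Y : SmoothField (4 * n + 3) M)
    {Z Z' : SmoothField (4 * n + 3) M} {x : M} (h : Z x = Z' x) :
    curv D X Y Z x = curv D X Y Z' x := by
  obtain ⟨s, hs⟩ := exists_linear_extension (d := 4 * n + 3) x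
  refine ext_inner_right ℝ fun z ↦ ?_
  have hz : s z x = z := by rw [(hs z).self_of_nhds, FiberBundle.extend_apply_self]
  rw [← hz, ip_curv_skew hm X Y Z (s z) (S.ξf 0) (S.ξf_ne_zero 0 x),
    ip_curv_skew hm X Y Z' (s z) (S.ξf 0) (S.ξf_ne_zero 0 x), h]

theorem IsThreeSasaki.isCurvature (hn : 1 ≤ n) (hS : S.IsThreeSasaki α δ)
    (hβ : S.HasCanonicalDerivative D β) (hD : IsMetricWithSkewTorsion D) {x : M}
    (s : TangentSpace (𝓡 (4 * n + 3)) x →ₗ[ℝ] SmoothField (4 * n + 3) M) (hs : ∀ v, s v x = v) :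
    (S.at' x).IsCurvature α δ (curvForm D s) := by
  have hT := hS.torsion_eq hn hβ hD
  obtain rfl := hS.beta_eq hn hβ hD
  have hR : ∀ u v w z, curvForm D s u v w z = inner ℝ (curv D (s u) (s v) (s w) x) z :=
    fun _ _ _ _ ↦ rfl
  have hskew : ∀ u v w z, curvForm D s u v w z = - curvForm D s u v z w := fun u v w z ↦ by
    have h := ip_curv_skew hD.metric (s u) (s v) (s w) (s z) (S.ξf 0) (S.ξf_ne_zero 0 x)
    rw [hs, hs] at h
    rw [hR, hR, h, real_inner_comm]
  have hφ : ∀ i u v w z, curvForm D s u v ((S.at' x).φ i w) z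
      + curvForm D s u v w ((S.at' x).φ i z) =
      (S.at' x).F α δ (i + 2) u v * inner ℝ ((S.at' x).φ (i + 1) w) z
        - (S.at' x).F α δ (i + 1) u v * inner ℝ ((S.at' x).φ (i + 2) w) z := fun i u v w z ↦ by
    have h : curv D (s u) (s v) (s ((S.at' x).φ i w)) x = curv D (s u) (s v) (S.φf i (s w)) x :=
      curv_congr S hD.metric _ _ (by rw [hs, φf_apply, hs])
    rw [hR, hR, h, hS.curv_φf hβ, inner_add_left, (S.at' x).inner_φ_left, hs, hs, hs,
      inner_sub_left, real_inner_smul_left, real_inner_smul_left]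
    ring
  refine ⟨fun u v w z ↦ ?_, hskew, fun u v w z ↦ ?_,
    (S.at' x).ξ_apply_of_φ_apply hskew hφ, hφ⟩
  · rw [hR, hR, curv_swap, ContMDiffSection.coe_neg, Pi.neg_apply, inner_neg_left]
  · have h := sum_curv_apply D (s u) (s v) (s w) x fun X Y Z ↦ hβ.nab_tors hD.metric hT X Y Z x
    rw [hs, hs, hs] at h
    -- Skew torsion turns `g(T(T(u,v),w),z)` into `g(T(u,v),T(w,z))`, the form used in
    -- `IsCurvature`.
    have hsk : ∀ u v w z : TangentSpace (𝓡 (4 * n + 3)) x,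
        (inner ℝ (D.torsion x (D.torsion x u v) w) z : ℝ) =
          inner ℝ ((S.at' x).canonicalTorsion α δ u v) ((S.at' x).canonicalTorsion α δ w z) :=
      fun u v w z ↦ by
        rw [D.torsion_antisymm (D.torsion x u v) w, inner_neg_left, hD.skew, neg_neg,
          real_inner_comm, hT x u v, hT x w z]
    exact (ThreeContactSpace.inner_add_three_left h z).trans
      (congrArg₂ (· + ·) (congrArg₂ (· + ·) (hsk u v w z) (hsk v w u z)) (hsk w u v z))

theorem IsThreeSasaki.ricci_eq (hn : 1 ≤ n) (hS : S.IsThreeSasaki α δ)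
    (hβ : S.HasCanonicalDerivative D β) (hD : IsMetricWithSkewTorsion D) (x : M)
    (u v : TangentSpace (𝓡 (4 * n + 3)) x) :
    ricci D x u v = 4 * α * (δ * (n + 2) - 3 * α) * inner ℝ u v
      + 4 * α * (δ * (2 - n) - 5 * α) * ∑ i, S.η i x u * S.η i x v := by
  obtain ⟨s, hs⟩ := exists_linear_extension (d := 4 * n + 3) x
  have hsx : ∀ v, s v x = v := fun v ↦ by
    rw [(hs v).self_of_nhds, FiberBundle.extend_apply_self]
  have h := (hS.isCurvature hn hβ hD s hsx).ricci_eq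
    (stdOrthonormalBasis ℝ (TangentSpace (𝓡 (4 * n + 3)) x)) (hS.torsion_eq hn hβ hD x)
    (finrank_tangentSpace x) u v
  refine Eq.trans (Finset.sum_congr rfl fun a _ ↦ ?_) h
  rw [curvatureAt, curvature_eq_curv D (s _) (s u) (s v) (hs _) (hs u) (hs v)]
  rfl

end AlmostThreeContactMetric
end ThreeSasaki

end

/-! ### The theorem and its two consequences -/

theorem mainTheorem9 {n : ℕ} (hn : 1 ≤ n) {M : Type*} [TopologicalSpace M] [T2Space M]
    [SecondCountableTopology M] [Nonempty M]
    [ChartedSpace (EuclideanSpace ℝ (Fin (4 * n + 3))) M] [IsManifold (𝓡 (4 * n + 3)) ∞ M]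
    [RiemannianBundle (fun x : M ↦ TangentSpace (𝓡 (4 * n + 3)) x)]
    [IsContMDiffRiemannianBundle (𝓡 (4 * n + 3)) ∞ (EuclideanSpace ℝ (Fin (4 * n + 3)))
      (fun x : M ↦ TangentSpace (𝓡 (4 * n + 3)) x)]
    (S : ThreeSasaki.AlmostThreeContactMetric n M) (α δ : ℝ) (hS : S.IsThreeSasaki α δ)
    (D : ThreeSasaki.LinearConnection (4 * n + 3) M) (hD : S.IsCanonicalConnection D) :
    (∀ (x : M) (u v : TangentSpace (𝓡 (4 * n + 3)) x),
      ThreeSasaki.ricci D x u v =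
        4 * α * (δ * ((n : ℝ) + 2) - 3 * α) * inner ℝ u v
          + 4 * α * (δ * (2 - (n : ℝ)) - 5 * α) * ∑ i, S.η i x u * S.η i x v) ∧
    (∀ (x : M) (u v : TangentSpace (𝓡 (4 * n + 3)) x),
      ThreeSasaki.ricci D x u v =
        4 * α * (δ * ((n : ℝ) + 2) - 3 * α) * inner ℝ (S.hor x u) (S.hor x v)
          + 16 * α * (δ - 2 * α) * inner ℝ (S.vert x u) (S.vert x v)) ∧
    (ThreeSasaki.IsNablaEinstein D ↔ δ * (2 - (n : ℝ)) = 5 * α) ∧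
    ¬ ThreeSasaki.IsNablaRicciFlat D := by
  obtain ⟨β, -, hβ⟩ := hD.canonical
  have hsmooth := hD.metric_skew.smooth
  have hric := hS.ricci_eq hn hβ hD.metric_skew
  have hα := hS.α_ne_zero
  have hdim : ∀ x : M, 3 < Module.finrank ℝ (TangentSpace (𝓡 (4 * n + 3)) x) := fun x ↦ by
    rw [ThreeSasaki.finrank_tangentSpace]; omega
  have hpos : (0 : ℝ) < 4 * n + 3 := by positivity
  obtain ⟨x⟩ := ‹Nonempty M›
  obtain ⟨u, hu, hu0⟩ := (S.at' x).exists_horizontal_ne_zero (hdim x)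
  have hη : ∀ i, S.η i x u = 0 := hu
  have huu : (inner ℝ u u : ℝ) ≠ 0 := by simpa using hu0
  refine ⟨hric, fun x u v ↦ ?_, ⟨fun h ↦ ?_, fun h x u v ↦ ?_⟩, fun h ↦ ?_⟩
  · have h1 : (inner ℝ (S.hor x u) (S.hor x v) : ℝ) = inner ℝ u v - ∑ i, S.η i x u * S.η i x v :=
      (S.at' x).inner_hor u v
    have h2 : (inner ℝ (S.vert x u) (S.vert x v) : ℝ) = ∑ i, S.η i x u * S.η i x v :=
      (S.at' x).inner_vert u v
    rw [hric, h1, h2]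
    ring
  · have hscal : ThreeSasaki.scal D x = 4 * α * (δ * ((n : ℝ) + 2) - 3 * α) * (4 * n + 3)
        + 4 * α * (δ * (2 - (n : ℝ)) - 5 * α) * 3 := by
      have h3 := (S.at' x).sum_η_self (stdOrthonormalBasis ℝ (TangentSpace (𝓡 (4 * n + 3)) x))
      rw [ThreeSasaki.scal]
      simp only [hric, Finset.sum_add_distrib, ← Finset.mul_sum]
      congr 1
      · simp [ThreeSasaki.finrank_tangentSpace]
      · exact congrArg _ h3
    -- On a horizontal vector only the coefficient of `g` survives, while the trace also sees `3`
    -- times that of `∑ η_i ⊗ η_i`. The Einstein condition therefore makes the latter vanish.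
    have h := h x u u
    rw [hric, hscal] at h
    simp only [hη, mul_zero, Finset.sum_const_zero, add_zero, add_self_div_two] at h
    have h := mul_right_cancel₀ huu h
    push_cast at h
    rw [eq_div_iff hpos.ne'] at h
    have h4 : (12 * α) * (δ * (2 - (n : ℝ)) - 5 * α) = 0 := by linarith
    have := (mul_eq_zero.mp h4).resolve_left (by simpa using hα)
    linarith
  · have hc : δ * (2 - (n : ℝ)) - 5 * α = 0 := by linarith
    have hr : ∀ u v, ThreeSasaki.ricci D x u v =
        4 * α * (δ * ((n : ℝ) + 2) - 3 * α) * inner ℝ u v := fun u v ↦ by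
      rw [hric, hc]; ring
    have hscal : ThreeSasaki.scal D x = 4 * α * (δ * ((n : ℝ) + 2) - 3 * α) * (4 * n + 3) := by
      rw [ThreeSasaki.scal]
      simp only [hr, ← Finset.mul_sum]
      congr 1
      simp [ThreeSasaki.finrank_tangentSpace]
    rw [hscal, hr, hr, real_inner_comm u v]
    push_cast
    rw [mul_div_cancel_right₀ _ hpos.ne', add_self_div_two]
  · have h1 := h x u u
    rw [hric] at h1
    simp only [hη, mul_zero, Finset.sum_const_zero, add_zero] at h1
    -- The vertical direction forces `δ = 2α`. The horizontal coefficient is then `4α²(2n + 1)`,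
    -- which is positive.
    have h2 := h x (S.ξ 0 x) (S.ξ 0 x)
    have h3 : ∑ i, S.η i x (S.ξ 0 x) * S.η i x (S.ξ 0 x) = 1 := by
      have e0 : S.η 0 x (S.ξ 0 x) = 1 := S.η_ξ 0 x
      have e1 : S.η (0 + 1) x (S.ξ 0 x) = 0 := (S.at' x).η_one_ξ 0
      have e2 : S.η (0 + 2) x (S.ξ 0 x) = 0 := (S.at' x).η_two_ξ 0
      rw [ThreeSasaki.sum_fin_three_cyclic _ 0, e0, e1, e2]
      norm_num
    have h4 : (inner ℝ (S.ξ 0 x) (S.ξ 0 x) : ℝ) = 1 :=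
      ((S.at' x).inner_ξ 0 _).trans (S.η_ξ 0 x)
    rw [hric, h3, h4] at h2
    have h5 := (mul_eq_zero.mp h1).resolve_right huu
    have h6 : (16 * α) * (δ - 2 * α) = 0 := by linarith
    have h7 : δ = 2 * α := by
      have := (mul_eq_zero.mp h6).resolve_left (by simpa using hα)
      linarith
    rw [h7] at h5
    have h8 : (4 * α ^ 2) * (2 * n + 1) = 0 := by linarith
    have h9 : (0 : ℝ) < (4 * α ^ 2) * (2 * n + 1) := by positivity
    exact h9.ne' h8
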